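/- For an integer $N\ge 1$ and a real parameter $j>0$ consider the continuous-time Markov process on $\{0,1\}^{[-N,N]}$, where $[-N,N]=\{-N,-N+1,\dots,N\}$, with generator $L=L_0+L_{b,+}+L_{b,-}$ given, for $f:\{0,1\}^{[-N,N]}\to\mathbb R$, by $$L_0f(\eta)=\frac12\sum_{x=-N}^{N-1}\bigl[f(\eta^{(x,x+1)})-f(\eta)\bigr],\qquad L_{b,\pm}f(\eta)=\frac{j}{2N}\sum_{x\in I_\pm}D_\pm\eta(x)\,\bigl[f(\eta^{(x)})-f(\eta)\bigr].$$ Here $\eta^{(x,x+1)}$ is $\eta$ with the values at $x$ and $x+1$ exchanged, $\eta^{(x)}$ is $\eta$ with the value at $x$ changed from $\eta(x)$ to $1-\eta(x)$, $I_+=\{N-1,N\}$, $I_-=\{-N,-N+1\}$, and $$D_+\eta(x)=(1-\eta(x))\,\eta(x+1)\cdots\eta(N),\qquad D_-\eta(x)=\eta(x)\,(1-\eta(x-1))\cdots(1-\eta(-N)).$$ Let $S_t=e^{Lt}$, and for a probability measure $\mu$ on $\{0,1\}^{[-N,N]}$ let $\mu S_t$ be the law at time $t$ of the process started from $\mu$,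 that is, $(\mu S_t)[f]=\mu[S_tf]$ for all $f$. For a signed measure $\lambda$ on $\{0,1\}^{[-N,N]}$ put $\|\lambda\|=\sum_\eta|\lambda(\eta)|$. **Theorem.** Let $j>0$. There are constants $c,b>0$, independent of $N$, such that for every integer $N\ge1$ the process has a unique stationary probability measure $\mu^{\rm st}_N$, and $$\|\mu_NS_t-\mu^{\rm st}_N\|\le c\,N\,e^{-bN^{-2}t}\qquad\text{for all initial probability measures }\mu_N\text{ and all }t>0.$$ -/

import Mathlib

noncomputable section

namespace CurrentReservoir

/-- The sites of the interval `[-N, N]` of integers. -/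
abbrev Site (N : ℕ) : Type := {x : ℤ // x ∈ Finset.Icc (-(N : ℤ)) (N : ℤ)}

/-- The configuration space `{0,1}^{[-N,N]}`; `true` stands for an occupied site. -/
abbrev Config (N : ℕ) : Type := Site N → Bool

/-- The occupation number `η(x) ∈ {0,1}` as a real number. -/
def occ {N : ℕ} (η : Config N) (x : Site N) : ℝ := if η x = true then 1 else 0

/-- `η^{(x,y)}`: the contents of the sites `x` and `y` are exchanged. -/
def exchange {N : ℕ} (η : Config N) (x y : Site N) : Config N :=
  fun z => η (Equiv.swap x y z)

/-- `η^{(x)}`: the occupation of the site `x` is changed. -/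
def flipAt {N : ℕ} (η : Config N) (x : Site N) : Config N :=
  Function.update η x (!(η x))

/-- The nearest neighbour bonds `(x, x+1)`, `-N ≤ x ≤ N-1`. -/
def bonds (N : ℕ) : Finset (Site N × Site N) :=
  Finset.univ.filter (fun p => (p.2 : ℤ) = (p.1 : ℤ) + 1)

/-- `I_+ = {N-1, N}`. -/
def Iplus (N : ℕ) : Finset (Site N) :=
  Finset.univ.filter (fun x => (x : ℤ) = (N : ℤ) - 1 ∨ (x : ℤ) = (N : ℤ))

/-- `I_- = {-N, -N+1}`. -/
def Iminus (N : ℕ) : Finset (Site N) :=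
  Finset.univ.filter (fun x => (x : ℤ) = -(N : ℤ) ∨ (x : ℤ) = -(N : ℤ) + 1)

/-- `D_+ η(x) = (1 - η(x)) η(x+1) ⋯ η(N)`. -/
def Dplus {N : ℕ} (η : Config N) (x : Site N) : ℝ :=
  (1 - occ η x) * ∏ y ∈ Finset.univ.filter (fun y : Site N => x < y), occ η y

/-- `D_- η(x) = η(x) (1 - η(x-1)) ⋯ (1 - η(-N))`. -/
def Dminus {N : ℕ} (η : Config N) (x : Site N) : ℝ :=
  occ η x * ∏ y ∈ Finset.univ.filter (fun y : Site N => y < x), (1 - occ η y)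

/-- The stirring generator `L_0`. -/
def stirring (N : ℕ) (f : Config N → ℝ) (η : Config N) : ℝ :=
  (1 / 2 : ℝ) * ∑ p ∈ bonds N, (f (exchange η p.1 p.2) - f η)

/-- The birth generator `L_{b,+}`. -/
def births (N : ℕ) (j : ℝ) (f : Config N → ℝ) (η : Config N) : ℝ :=
  j / (2 * (N : ℝ)) * ∑ x ∈ Iplus N, Dplus η x * (f (flipAt η x) - f η)

/-- The death generator `L_{b,-}`. -/
def deaths (N : ℕ) (j : ℝ) (f : Config N → ℝ) (η : Config N) : ℝ :=
  j / (2 * (N : ℝ)) * ∑ x ∈ Iminus N, Dminus η x * (f (flipAt η x) - f η)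

/-- The generator `L = L_0 + L_{b,+} + L_{b,-}`, as a linear operator on the functions on the
configuration space. -/
def generator (N : ℕ) (j : ℝ) : (Config N → ℝ) →ₗ[ℝ] (Config N → ℝ) where
  toFun f η := stirring N f η + (births N j f η + deaths N j f η)
  map_add' f g := by
    funext η
    have e : ∀ ξ : Config N, (f + g) ξ - (f + g) η = (f ξ - f η) + (g ξ - g η) := by
      intro ξ; simp only [Pi.add_apply]; ring
    simp only [stirring, births, deaths, e, mul_add, Finset.sum_add_distrib]
    simp only [Pi.add_apply]
    ring
  map_smul' a f := by
    funext η
    simp only [stirring, births, deaths, Pi.smul_apply, smul_eq_mul, ← mul_sub,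
      mul_left_comm _ a, ← Finset.mul_sum, RingHom.id_apply, mul_add]

/-- The semigroup `S_t = e^{Lt}` (exponential series of operators on the finite dimensional space
of functions on the configuration space). -/
def semigroup (N : ℕ) (j t : ℝ) : (Config N → ℝ) →L[ℝ] (Config N → ℝ) :=
  NormedSpace.exp (t • LinearMap.toContinuousLinearMap (generator N j))

/-- A signed measure `lam` on the configuration space is given by its values `lam η`;
this is the integral `lam[f]`. -/
def expect {N : ℕ} (lam : Config N → ℝ) (f : Config N → ℝ) : ℝ := ∑ η, lam η * f η

/-- The probability measures on the configuration space. -/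
def IsProb {N : ℕ} (μ : Config N → ℝ) : Prop := (∀ η, 0 ≤ μ η) ∧ ∑ η, μ η = 1

/-- The law `μ S_t` at time `t` of the process started from `μ`; its value at `η` is
`μ[S_t 1_η]`, where `1_η` is the indicator function of `{η}`. -/
def law (N : ℕ) (j t : ℝ) (μ : Config N → ℝ) : Config N → ℝ :=
  fun η => expect μ (semigroup N j t (Pi.single η 1))

/-- `(μ S_t)[f] = μ[S_t f]` for all functions `f`. -/
theorem expect_law (N : ℕ) (j t : ℝ) (μ f : Config N → ℝ) :
    expect (law N j t μ) f = expect μ (semigroup N j t f) := by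
  have hf : f = ∑ η, f η • (Pi.single η (1 : ℝ) : Config N → ℝ) := by
    funext ξ
    simp [Finset.sum_apply, Pi.single_apply]
  conv_rhs => rw [hf, map_sum]
  simp only [expect, law, Finset.sum_apply, Finset.mul_sum, Finset.sum_mul, map_smul,
    Pi.smul_apply, smul_eq_mul]
  rw [Finset.sum_comm]
  refine Finset.sum_congr rfl fun _ _ => Finset.sum_congr rfl fun _ _ => ?_
  ring

/-- The norm `‖lam‖ = ∑_η |lam(η)|` of a signed measure. -/
def tvNorm {N : ℕ} (lam : Config N → ℝ) : ℝ := ∑ η, |lam η|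

/-- `μ` is a stationary (probability) measure of the process. -/
def IsStationary (N : ℕ) (j : ℝ) (μ : Config N → ℝ) : Prop :=
  IsProb μ ∧ ∀ t : ℝ, 0 ≤ t → law N j t μ = μ

end CurrentReservoir

end

noncomputable section

namespace CurrentReservoir

/-! ### Exponentials of bounded operators -/

section Exponential

variable {V ι : Type*} [NormedAddCommGroup V] [NormedSpace ℝ V] [CompleteSpace V]

/-! Compare two configurations that differ at one site z only. Stirring carries this discrepancy
along; a birth or death either pushes it one step away from the wall or destroys it. It is destroyed
at the right end when it and a particle occupy {N-1, N}, and at the left end when it and a hole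
occupy {-N, -N+1}. If a function F(z, η) with values in [1/2, 1] contracts at rate b under this
motion, then every bound |grad f| ≤ A F improves to e^{-bt} A F under the semigroup
(`abs_grad_semigroup_le`). Changing at most 2N+1 sites one at a time bounds the oscillation of S_t f
by a multiple of N e^{-bt}, and duality gives the norm bound, hence also existence and uniqueness of
the stationary measure (`exists_stationary_of_decay`).

F is 1 minus a sum of B(z, y) over the particles y, minus the mirror image of this sum over the
holes. Stirring acts on such sums through the motion of the pair (z, y) alone, so one needs an
inequality for B with a strict gain β for each pair. Each site other than z holds a particle or a
hole, so exactly 2N pairs contribute and the rate is 2Nβ whatever η is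
(`exists_stationary_of_isPairWeight`).

In suitable coordinates the pair performs a reflected walk on a two-dimensional grid of side 2N, and
its destruction is a source of strength of order 1/N at the corner. Spread over about N² points,
this allows β of order N⁻³, hence the rate N⁻². The weight is 1/N times the logarithmic profile of a
planar Green function, whose sums along lines stay bounded. A small quadratic term supplies the
gain, and an exponential profile takes over far from the corner, because a maximum of two
subsolutions is again one (`radial_gen`). The finitely many small N are covered by a cruder weight
(`exists_isGridWeight`). -/

theorem hasSum_exp_smul_apply (T : V →L[ℝ] V) (t : ℝ) (f : V) :
    HasSum (fun n : ℕ => (t ^ n / n.factorial) • (T ^ n) f) (NormedSpace.exp (t • T) f) := by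
  have h := NormedSpace.exp_series_hasSum_exp' (𝕂 := ℝ) (t • T)
  have h2 := (ContinuousLinearMap.apply ℝ V f).hasSum h
  have e : (fun n : ℕ => (t ^ n / n.factorial) • (T ^ n) f) =
      (fun n : ℕ => (ContinuousLinearMap.apply ℝ V f) ((n.factorial⁻¹ : ℝ) • (t • T) ^ n)) := by
    funext n
    simp [smul_pow, smul_smul, div_eq_inv_mul]
  rw [e]
  exact h2

/-- Uniformization: adding the total jump rate to the generator gives a positive operator at the
price of a scalar factor, so that estimates can be made term by term in the exponential series. -/
theorem exp_smul_sub_smul_one (T : V →L[ℝ] V) (Λ t : ℝ) :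
    NormedSpace.exp (t • (T - Λ • (1 : V →L[ℝ] V))) =
      Real.exp (-(Λ * t)) • NormedSpace.exp (t • T) := by
  have e : t • (T - Λ • (1 : V →L[ℝ] V)) =
      algebraMap ℝ (V →L[ℝ] V) (-(Λ * t)) + t • T := by
    rw [Algebra.algebraMap_eq_smul_one, smul_sub, smul_smul, neg_smul, mul_comm t Λ]
    abel
  let _ : NormedAlgebra ℚ (V →L[ℝ] V) := NormedAlgebra.restrictScalars ℚ ℝ (V →L[ℝ] V)
  rw [e, NormedSpace.exp_add_of_commute (Algebra.commutes _ _),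
    ← NormedSpace.algebraMap_exp_comm, ← Real.exp_eq_exp_ℝ, Algebra.algebraMap_eq_smul_one,
    smul_mul_assoc, one_mul]

/-- A bound on a family of linear functionals which is multiplied by at most `r` under `T` is
multiplied by at most `e^{tr}` under `e^{tT}`. -/
theorem abs_exp_smul_apply_le (T : V →L[ℝ] V) (ℓ : ι → V →L[ℝ] ℝ) (w : ι → ℝ) {r : ℝ}
    (hr : 0 ≤ r)
    (hT : ∀ f A, 0 ≤ A → (∀ i, |ℓ i f| ≤ A * w i) → ∀ i, |ℓ i (T f)| ≤ r * A * w i)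
    {t : ℝ} (ht : 0 ≤ t) {f : V} {A : ℝ} (hA : 0 ≤ A) (hf : ∀ i, |ℓ i f| ≤ A * w i) (i : ι) :
    |ℓ i (NormedSpace.exp (t • T) f)| ≤ Real.exp (t * r) * A * w i := by
  have hpow : ∀ n : ℕ, ∀ i, |ℓ i ((T ^ n) f)| ≤ r ^ n * A * w i := by
    intro n
    induction n with
    | zero => simpa using hf
    | succ n ih =>
      intro i
      have := hT ((T ^ n) f) (r ^ n * A) (by positivity) ih i
      rw [pow_succ', mul_apply_eq_comp, pow_succ']
      simpa [mul_assoc] using this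
  have h1 := (ℓ i).hasSum (hasSum_exp_smul_apply T t f)
  have h2 : HasSum (fun n : ℕ => ((t * r) ^ n / n.factorial) * (A * w i))
      (Real.exp (t * r) * (A * w i)) := by
    apply HasSum.mul_right
    rw [Real.exp_eq_exp_ℝ]
    exact NormedSpace.expSeries_div_hasSum_exp (t * r)
  have hle : ∀ n : ℕ, ‖ℓ i ((t ^ n / n.factorial) • (T ^ n) f)‖ ≤
      ((t * r) ^ n / n.factorial) * (A * w i) := by
    intro n
    rw [map_smul, norm_smul, Real.norm_eq_abs, Real.norm_eq_abs,
      abs_of_nonneg (by positivity : (0 : ℝ) ≤ t ^ n / n.factorial)]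
    calc t ^ n / n.factorial * |ℓ i ((T ^ n) f)|
        ≤ t ^ n / n.factorial * (r ^ n * A * w i) := by
          gcongr
          exact hpow n i
      _ = _ := by rw [mul_pow]; ring
  have h3 := tsum_of_norm_bounded h2 hle
  rw [h1.tsum_eq] at h3
  simpa [mul_assoc] using h3

/-- A positive operator has a positive exponential. -/
theorem exp_smul_apply_nonneg {X : Type*} [Fintype X] (T : (X → ℝ) →L[ℝ] (X → ℝ))
    (hT : ∀ f, 0 ≤ f → 0 ≤ T f) {t : ℝ} (ht : 0 ≤ t) {f : X → ℝ} (hf : 0 ≤ f) :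
    0 ≤ NormedSpace.exp (t • T) f := by
  have hpow : ∀ n : ℕ, 0 ≤ (T ^ n) f := by
    intro n
    induction n with
    | zero => simpa using hf
    | succ n ih =>
      rw [pow_succ', mul_apply_eq_comp]
      exact hT _ ih
  have h := hasSum_exp_smul_apply T t f
  refine h.nonneg fun n => ?_
  have : (0 : ℝ) ≤ t ^ n / n.factorial := by positivity
  exact smul_nonneg this (hpow n)

/-- A vector in the kernel of `T` is fixed by `e^{tT}`. -/
theorem exp_smul_apply_of_apply_eq_zero (T : V →L[ℝ] V) (t : ℝ) {f : V} (hf : T f = 0) :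
    NormedSpace.exp (t • T) f = f := by
  have h := hasSum_exp_smul_apply T t f
  have h0 := hasSum_single (f := fun n : ℕ => (t ^ n / n.factorial) • (T ^ n) f) 0 (by
    intro n hn
    obtain ⟨m, rfl⟩ := Nat.exists_eq_succ_of_ne_zero hn
    simp [pow_succ, hf])
  simpa using h.unique h0

end Exponential

end CurrentReservoir

/-! ### Births as a filling map, deaths as births under particle-hole reflection -/

namespace CurrentReservoir

variable {N : ℕ}

/-- The rightmost site `N`. -/
def top (N : ℕ) : Site N := ⟨N, by simp⟩

/-- The site `N - 1`. -/
def subTop (hN : 1 ≤ N) : Site N := ⟨(N : ℤ) - 1, by simp; omega⟩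

/-- The reflection `x ↦ -x` of the sites. -/
def negSite (x : Site N) : Site N := ⟨-(x : ℤ), by have := x.2; simp only [Finset.mem_Icc] at *; omega⟩

/-- The reflection of a configuration, composed with the exchange of particles and holes. -/
def refl (η : Config N) : Config N := fun x => !(η (negSite x))

/-- A particle is put at the rightmost empty site of `{N-1, N}`, if there is one. -/
def fill (hN : 1 ≤ N) (η : Config N) : Config N :=
  if η (top N) = true then Function.update η (subTop hN) true else Function.update η (top N) true

@[simp] theorem negSite_negSite (x : Site N) : negSite (negSite x) = x := by
  ext; simp [negSite]

@[simp] theorem negSite_inj {x y : Site N} : negSite x = negSite y ↔ x = y := by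
  constructor
  · intro h; simpa using congrArg negSite h
  · rintro rfl; rfl

@[simp] theorem coe_negSite (x : Site N) : ((negSite x : Site N) : ℤ) = -(x : ℤ) := rfl
@[simp] theorem coe_top : ((top N : Site N) : ℤ) = N := rfl
@[simp] theorem coe_subTop (hN : 1 ≤ N) : ((subTop hN : Site N) : ℤ) = N - 1 := rfl

theorem subTop_ne_top (hN : 1 ≤ N) : subTop hN ≠ top N := by
  intro h; have := congrArg (Subtype.val) h; simp at this

@[simp] theorem refl_refl (η : Config N) : refl (refl η) = η := by
  funext x; simp [refl]

/-- The reflection of the sites as an equivalence. -/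
def negEquiv (N : ℕ) : Site N ≃ Site N := ⟨negSite, negSite, negSite_negSite, negSite_negSite⟩

theorem refl_update (η : Config N) (z : Site N) (v : Bool) :
    refl (Function.update η z v) = Function.update (refl η) (negSite z) (!v) := by
  funext x
  by_cases h : x = negSite z
  · subst h; simp [refl]
  · have : negSite x ≠ z := by rintro rfl; simp at h
    simp [refl, h, this]

theorem le_top (x : Site N) : (x : ℤ) ≤ N := by
  have := x.2; simp only [Finset.mem_Icc] at this; omega

theorem neg_le_coe (x : Site N) : -(N : ℤ) ≤ x := by
  have := x.2; simp only [Finset.mem_Icc] at this; omega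

theorem Iplus_eq (hN : 1 ≤ N) : Iplus N = {subTop hN, top N} := by
  ext x
  simp only [Iplus, Finset.mem_filter, Finset.mem_univ, true_and, Finset.mem_insert,
    Finset.mem_singleton, Subtype.ext_iff, coe_top, coe_subTop]

theorem Dplus_top (η : Config N) : Dplus η (top N) = 1 - occ η (top N) := by
  have : Finset.univ.filter (fun y : Site N => top N < y) = ∅ := by
    ext y
    have := le_top y
    simp [← Subtype.coe_lt_coe]
    omega
  rw [Dplus, this, Finset.prod_empty, mul_one]

theorem Dplus_subTop (hN : 1 ≤ N) (η : Config N) :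
    Dplus η (subTop hN) = (1 - occ η (subTop hN)) * occ η (top N) := by
  have : Finset.univ.filter (fun y : Site N => subTop hN < y) = {top N} := by
    ext y
    have := le_top y
    simp [← Subtype.coe_lt_coe, Subtype.ext_iff]
    omega
  rw [Dplus, this, Finset.prod_singleton]

/-- At most one of the two rates is nonzero, so the births are a single jump at constant rate; when
both sites are full, `fill` changes nothing and the jump contributes 0. -/
theorem births_eq (hN : 1 ≤ N) (j : ℝ) (f : Config N → ℝ) (η : Config N) :
    births N j f η = j / (2 * (N : ℝ)) * (f (fill hN η) - f η) := by
  rw [births, Iplus_eq hN, Finset.sum_pair (subTop_ne_top hN), Dplus_top, Dplus_subTop]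
  congr 1
  unfold fill flipAt occ
  cases h1 : η (top N) <;> cases h2 : η (subTop hN) <;> simp
  · have : Function.update η (subTop hN) true = η := by rw [← h2]; simp
    simp [this]

theorem occ_refl (η : Config N) (x : Site N) : occ (refl η) x = 1 - occ η (negSite x) := by
  unfold occ refl
  cases η (negSite x) <;> simp

theorem Dminus_eq (η : Config N) (x : Site N) : Dminus η x = Dplus (refl η) (negSite x) := by
  rw [Dminus, Dplus, occ_refl]
  simp only [negSite_negSite, sub_sub_cancel]
  congr 1
  refine Finset.prod_bij (fun y _ => negSite y) ?_ ?_ ?_ ?_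
  · intro y hy
    simp only [Finset.mem_filter, Finset.mem_univ, true_and, ← Subtype.coe_lt_coe, coe_negSite] at *
    omega
  · intro a _ b _ h; simpa using h
  · intro y hy
    refine ⟨negSite y, ?_, by simp⟩
    simp only [Finset.mem_filter, Finset.mem_univ, true_and, ← Subtype.coe_lt_coe, coe_negSite] at *
    omega
  · intro y _; simp [occ_refl]

theorem deaths_eq (hN : 1 ≤ N) (j : ℝ) (f : Config N → ℝ) (η : Config N) :
    deaths N j f η = j / (2 * (N : ℝ)) * (f (refl (fill hN (refl η))) - f η) := by
  have h := births_eq hN j (fun ξ => f (refl ξ)) (refl η)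
  simp only [refl_refl] at h
  rw [← h, deaths, births]
  congr 1
  refine Finset.sum_bij (fun y _ => negSite y) ?_ ?_ ?_ ?_
  · intro y hy
    simp only [Iplus, Iminus, Finset.mem_filter, Finset.mem_univ, true_and, coe_negSite] at *
    omega
  · intro a _ b _ h; simpa using h
  · intro y hy
    refine ⟨negSite y, ?_, by simp⟩
    simp only [Iplus, Iminus, Finset.mem_filter, Finset.mem_univ, true_and, coe_negSite] at *
    omega
  · intro y _
    rw [Dminus_eq]
    simp [flipAt, refl_update, refl]

/-- The generator as the difference of the jumps and the total jump rate. -/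
theorem generator_apply (hN : 1 ≤ N) (j : ℝ) (f : Config N → ℝ) (η : Config N) :
    generator N j f η = (1 / 2 * ∑ p ∈ bonds N, f (exchange η p.1 p.2)
      + j / (2 * (N : ℝ)) * f (fill hN η) + j / (2 * (N : ℝ)) * f (refl (fill hN (refl η))))
      - (1 / 2 * ((bonds N).card : ℝ) + 2 * (j / (2 * (N : ℝ)))) * f η := by
  change stirring N f η + (births N j f η + deaths N j f η) = _
  rw [births_eq hN, deaths_eq hN, stirring, Finset.sum_sub_distrib, Finset.sum_const, nsmul_eq_mul]
  ring

end CurrentReservoir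

/-! ### Motion of a single discrepancy -/

namespace CurrentReservoir

variable {N : ℕ}

/-- The effect on `f` of a discrepancy at the site `z`. -/
def grad (f : Config N → ℝ) (z : Site N) (η : Config N) : ℝ :=
  f (Function.update η z true) - f (Function.update η z false)

/-- The value of `F` after a particle was put at the right end of a configuration `η` with a
discrepancy at `z`; it is `0` if the discrepancy disappears. -/
def rightVal (hN : 1 ≤ N) (F : Site N → Config N → ℝ) (z : Site N) (η : Config N) : ℝ :=
  if z = top N then
    if η (subTop hN) = true then 0 else F (subTop hN) (Function.update η (top N) true)
  else if z = subTop hN then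
    if η (top N) = true then 0 else F (subTop hN) (Function.update η (top N) true)
  else F z (fill hN η)

theorem exchange_update (η : Config N) (x y z : Site N) (v : Bool) :
    exchange (Function.update η z v) x y =
      Function.update (exchange η x y) (Equiv.swap x y z) v := by
  funext w
  by_cases h : w = Equiv.swap x y z
  · subst h; simp [exchange]
  · have h' : Equiv.swap x y w ≠ z := by
      rintro rfl; simp at h
    simp [exchange, Function.update_of_ne h, Function.update_of_ne h']

/-- A discrepancy at N disappears if N-1 is occupied and otherwise moves to N-1. One at N-1
disappears if N is occupied and otherwise stays. Elsewhere it does not influence the birth. -/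
theorem abs_fill_sub_fill_le (hN : 1 ≤ N) {f : Config N → ℝ} {F : Site N → Config N → ℝ} {A : ℝ}
    (hf : ∀ z η, |grad f z η| ≤ A * F z η) (z : Site N) (η : Config N) :
    |f (fill hN (Function.update η z true)) - f (fill hN (Function.update η z false))| ≤
      A * rightVal hN F z η := by
  have hne := subTop_ne_top hN
  unfold rightVal
  split_ifs with h1 h2 h3 h4
  · subst h1
    have e : Function.update (Function.update η (top N) true) (subTop hN) true =
        Function.update η (top N) true := by
      rw [Function.update_eq_self_iff, Function.update_of_ne hne, h2]
    simp [fill, e]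
  · subst h1
    have e : Function.update (Function.update η (top N) true) (subTop hN) false =
        Function.update η (top N) true := by
      rw [Function.update_eq_self_iff, Function.update_of_ne hne]
      simpa using h2
    have := hf (subTop hN) (Function.update η (top N) true)
    rw [grad, e] at this
    simpa [fill] using this
  · subst h3
    simp [fill, Function.update_of_ne hne.symm, h4]
  · subst h3
    have := hf (subTop hN) (Function.update η (top N) true)
    rw [grad, Function.update_comm hne.symm, Function.update_comm hne.symm] at this
    simpa [fill, Function.update_of_ne hne.symm, h4] using this
  · have e : ∀ v, fill hN (Function.update η z v) = Function.update (fill hN η) z v := by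
      intro v
      unfold fill
      rw [Function.update_of_ne (Ne.symm h1)]
      split_ifs
      · rw [Function.update_comm h3]
      · rw [Function.update_comm h1]
    rw [e, e]
    exact hf z _

theorem grad_comp_refl (f : Config N → ℝ) (z : Site N) (η : Config N) :
    grad (fun ξ => f (refl ξ)) z η = -grad f (negSite z) (refl η) := by
  simp [grad, refl_update]

/-- If `F` decays at rate `b` along the motion of a single discrepancy, then the bounds by `F` on
the gradients decay at rate `b` along the process. -/
theorem abs_grad_shifted_generator_le (hN : 1 ≤ N) {j Λ b A : ℝ} (hj : 0 ≤ j) (hA : 0 ≤ A)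
    {F : Site N → Config N → ℝ} (hsymm : ∀ z η, F (negSite z) (refl η) = F z η)
    (hΛ : Λ = 1 / 2 * ((bonds N).card : ℝ) + 2 * (j / (2 * (N : ℝ))))
    (hF : ∀ z η, 1 / 2 * ∑ p ∈ bonds N, F (Equiv.swap p.1 p.2 z) (exchange η p.1 p.2)
      + j / (2 * (N : ℝ)) * rightVal hN F z η
      + j / (2 * (N : ℝ)) * rightVal hN F (negSite z) (refl η) ≤ (Λ - b) * F z η)
    {f : Config N → ℝ} (hf : ∀ z η, |grad f z η| ≤ A * F z η) (z : Site N) (η : Config N) :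
    |grad (fun ξ => generator N j f ξ + Λ * f ξ) z η| ≤ (Λ - b) * A * F z η := by
  have hf' : ∀ z η, |grad (fun ξ => f (refl ξ)) z η| ≤ A * F z η := by
    intro z η
    rw [grad_comp_refl, abs_neg, ← hsymm]
    exact hf _ _
  set ε := j / (2 * (N : ℝ)) with hε
  have hε0 : 0 ≤ ε := by positivity
  have e : grad (fun ξ => generator N j f ξ + Λ * f ξ) z η =
      1 / 2 * ∑ p ∈ bonds N, grad f (Equiv.swap p.1 p.2 z) (exchange η p.1 p.2)
      + ε * (f (fill hN (Function.update η z true)) - f (fill hN (Function.update η z false)))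
      - ε * (f (refl (fill hN (Function.update (refl η) (negSite z) true)))
        - f (refl (fill hN (Function.update (refl η) (negSite z) false)))) := by
    simp only [grad, generator_apply hN, ← hΛ, ← hε, refl_update, exchange_update, Bool.not_true,
      Bool.not_false, Finset.sum_sub_distrib]
    ring
  rw [e]
  have h1 : |∑ p ∈ bonds N, grad f (Equiv.swap p.1 p.2 z) (exchange η p.1 p.2)| ≤
      A * ∑ p ∈ bonds N, F (Equiv.swap p.1 p.2 z) (exchange η p.1 p.2) := by
    rw [Finset.mul_sum]
    exact (Finset.abs_sum_le_sum_abs _ _).trans (Finset.sum_le_sum fun p _ => hf _ _)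
  have h2 := mul_le_mul_of_nonneg_left (abs_fill_sub_fill_le hN hf z η) hε0
  have h3 := mul_le_mul_of_nonneg_left (abs_fill_sub_fill_le hN hf' (negSite z) (refl η)) hε0
  have h4 := mul_le_mul_of_nonneg_left (hF z η) hA
  rw [← abs_of_nonneg hε0, ← abs_mul, abs_of_nonneg hε0] at h2 h3
  rw [abs_le] at *
  constructor <;> nlinarith [h1.1, h1.2, h2.1, h2.2, h3.1, h3.2]

end CurrentReservoir

/-! ### From decay of gradients to convergence -/

namespace CurrentReservoir

open Filter Topology

variable {N : ℕ}

theorem abs_sub_update_le {h : Config N → ℝ} {D : ℝ} (hD : ∀ z η, |grad h z η| ≤ D)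
    (η : Config N) (z : Site N) (v : Bool) : |h (Function.update η z v) - h η| ≤ D := by
  have h0 : 0 ≤ D := (abs_nonneg _).trans (hD z η)
  have h1 := hD z η
  cases hv : η z <;> cases v
  · rw [← hv]; simpa using h0
  · have e : Function.update η z false = η := by rw [← hv]; simp
    rw [grad, e] at h1; exact h1
  · have e : Function.update η z true = η := by rw [← hv]; simp
    rw [grad, e, abs_sub_comm] at h1; exact h1
  · rw [← hv]; simpa using h0

theorem abs_sub_le_of_abs_grad_le {h : Config N → ℝ} {D : ℝ} (hD : ∀ z η, |grad h z η| ≤ D)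
    (η ξ : Config N) : |h η - h ξ| ≤ (2 * N + 1) * D := by
  have key : ∀ s : Finset (Site N), |h (s.piecewise η ξ) - h ξ| ≤ s.card * D := by
    intro s
    induction s using Finset.induction_on with
    | empty => simp
    | insert z s hz ih =>
      rw [Finset.piecewise_insert, Finset.card_insert_of_notMem hz]
      have h1 := abs_sub_update_le hD (s.piecewise η ξ) z (η z)
      have h2 := abs_sub_le (h (Function.update (s.piecewise η ξ) z (η z)))
        (h (s.piecewise η ξ)) (h ξ)
      push_cast
      linarith
  have := key Finset.univ
  rw [Finset.piecewise_univ, Finset.card_univ, Fintype.card_coe, Int.card_Icc] at this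
  have e : (((N : ℤ) + 1 - -(N : ℤ)).toNat : ℝ) = 2 * N + 1 := by
    have : ((N : ℤ) + 1 - -(N : ℤ)).toNat = 2 * N + 1 := by omega
    rw [this]; push_cast; ring
  rwa [e] at this

theorem generator_one (j : ℝ) : generator N j 1 = 0 := by
  funext η
  change stirring N 1 η + (births N j 1 η + deaths N j 1 η) = 0
  simp [stirring, births, deaths]

theorem semigroup_one (j t : ℝ) : semigroup N j t 1 = 1 :=
  exp_smul_apply_of_apply_eq_zero _ _ (generator_one j)

theorem semigroup_add (j s t : ℝ) (f : Config N → ℝ) :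
    semigroup N j (s + t) f = semigroup N j s (semigroup N j t f) := by
  let _ : NormedAlgebra ℚ ((Config N → ℝ) →L[ℝ] (Config N → ℝ)) :=
    NormedAlgebra.restrictScalars ℚ ℝ _
  rw [semigroup, add_smul, NormedSpace.exp_add_of_commute]
  · rfl
  · exact ((Commute.refl _).smul_left _).smul_right _

/-- The total jump rate. -/
def totalRate (N : ℕ) (j : ℝ) : ℝ := 1 / 2 * ((bonds N).card : ℝ) + 2 * (j / (2 * (N : ℝ)))

/-- The generator shifted by the total jump rate. -/
def shiftedGenerator (N : ℕ) (j : ℝ) : (Config N → ℝ) →L[ℝ] (Config N → ℝ) :=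
  LinearMap.toContinuousLinearMap (generator N j) +
    totalRate N j • (1 : (Config N → ℝ) →L[ℝ] (Config N → ℝ))

theorem shiftedGenerator_apply (j : ℝ) (f : Config N → ℝ) :
    shiftedGenerator N j f = fun ξ => generator N j f ξ + totalRate N j * f ξ := by
  funext ξ
  simp [shiftedGenerator]

theorem semigroup_eq (j t : ℝ) : semigroup N j t =
    Real.exp (-(totalRate N j * t)) • NormedSpace.exp (t • shiftedGenerator N j) := by
  rw [← exp_smul_sub_smul_one, shiftedGenerator, add_sub_cancel_right, semigroup]

theorem semigroup_nonneg (hN : 1 ≤ N) {j t : ℝ} (hj : 0 ≤ j) (ht : 0 ≤ t) {f : Config N → ℝ}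
    (hf : 0 ≤ f) : 0 ≤ semigroup N j t f := by
  rw [semigroup_eq]
  refine smul_nonneg (Real.exp_pos _).le (exp_smul_apply_nonneg _ ?_ ht hf)
  intro f hf η
  rw [shiftedGenerator_apply, Pi.zero_apply]
  simp only [generator_apply hN, totalRate, sub_add_cancel]
  have := Finset.sum_nonneg fun p (_ : p ∈ bonds N) => hf (exchange η p.1 p.2)
  have h1 := hf (fill hN η)
  have h2 := hf (refl (fill hN (refl η)))
  simp only [Pi.zero_apply] at this h1 h2
  positivity

theorem isProb_law (hN : 1 ≤ N) {j t : ℝ} (hj : 0 ≤ j) (ht : 0 ≤ t) {μ : Config N → ℝ}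
    (hμ : IsProb μ) : IsProb (law N j t μ) := by
  constructor
  · intro η
    refine Finset.sum_nonneg fun ξ _ => mul_nonneg (hμ.1 ξ) ?_
    refine semigroup_nonneg hN hj ht ?_ ξ
    intro ζ
    by_cases h : ζ = η
    · subst h; simp
    · simp [h]
  · have h := expect_law N j t μ 1
    rw [semigroup_one] at h
    simpa [expect, hμ.2] using h

theorem law_law (j s t : ℝ) (μ : Config N → ℝ) :
    law N j s (law N j t μ) = law N j (t + s) μ := by
  funext η
  change expect (law N j t μ) _ = expect μ _
  rw [expect_law, semigroup_add]

theorem continuous_law (j t : ℝ) : Continuous (law N j t) := by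
  unfold law expect
  fun_prop

theorem dist_le_tvNorm (μ ν : Config N → ℝ) : dist μ ν ≤ tvNorm (μ - ν) := by
  have h0 : 0 ≤ tvNorm (μ - ν) := Finset.sum_nonneg fun _ _ => abs_nonneg _
  rw [dist_eq_norm, pi_norm_le_iff_of_nonneg h0]
  intro η
  exact Finset.single_le_sum (f := fun η => |(μ - ν) η|) (fun _ _ => abs_nonneg _)
    (Finset.mem_univ η)

/-- Integrate h η - h ξ against the product coupling. -/
theorem expect_sub_expect_le {μ ν h : Config N → ℝ} (hμ : IsProb μ) (hν : IsProb ν) {D : ℝ}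
    (hD : ∀ η ξ, h η - h ξ ≤ D) : expect μ h - expect ν h ≤ D := by
  have e : expect μ h - expect ν h = ∑ η, ∑ ξ, μ η * ν ξ * (h η - h ξ) := by
    have e1 : ∀ η, ∑ ξ, μ η * ν ξ * (h η - h ξ) = μ η * h η - μ η * expect ν h := by
      intro η
      simp only [mul_sub, Finset.sum_sub_distrib]
      congr 1
      · rw [← Finset.sum_mul, ← Finset.mul_sum, hν.2, mul_one]
      · simp only [mul_assoc, ← Finset.mul_sum, expect]
    simp only [e1, Finset.sum_sub_distrib, ← Finset.sum_mul, hμ.2, one_mul]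
    rfl
  have e2 : D = ∑ η, ∑ ξ, μ η * ν ξ * D := by
    simp only [← Finset.sum_mul, ← Finset.mul_sum, hν.2, mul_one, hμ.2, one_mul]
  rw [e, e2]
  exact Finset.sum_le_sum fun η _ => Finset.sum_le_sum fun ξ _ =>
    mul_le_mul_of_nonneg_left (hD η ξ) (mul_nonneg (hμ.1 η) (hν.1 ξ))

section Decay

variable {j b : ℝ} {F : Site N → Config N → ℝ}

theorem abs_grad_semigroup_le (hN : 1 ≤ N) (hj : 0 ≤ j)
    (hsymm : ∀ z η, F (negSite z) (refl η) = F z η) (hpos : ∀ z η, 1 / 2 ≤ F z η)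
    (hF : ∀ z η, 1 / 2 * ∑ p ∈ bonds N, F (Equiv.swap p.1 p.2 z) (exchange η p.1 p.2)
      + j / (2 * (N : ℝ)) * rightVal hN F z η
      + j / (2 * (N : ℝ)) * rightVal hN F (negSite z) (refl η) ≤ (totalRate N j - b) * F z η)
    {A t : ℝ} (hA : 0 ≤ A) (ht : 0 ≤ t)
    {f : Config N → ℝ} (hf : ∀ z η, |grad f z η| ≤ A * F z η) (z : Site N) (η : Config N) :
    |grad (semigroup N j t f) z η| ≤ Real.exp (-(b * t)) * A * F z η := by
  have hval : ∀ z η, 0 ≤ rightVal hN F z η := by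
    intro z η
    have h0 : ∀ z η, 0 ≤ F z η := fun z η => by linarith [hpos z η]
    unfold rightVal
    split_ifs <;> first | exact le_rfl | exact h0 _ _
  have hr : 0 ≤ totalRate N j - b := by
    have h1 := hF z η
    have h2 := hpos z η
    have h3 : 0 ≤ ∑ p ∈ bonds N, F (Equiv.swap p.1 p.2 z) (exchange η p.1 p.2) :=
      Finset.sum_nonneg fun p _ => by linarith [hpos (Equiv.swap p.1 p.2 z) (exchange η p.1 p.2)]
    have h4 := hval z η
    have h5 := hval (negSite z) (refl η)
    have h6 : 0 ≤ (totalRate N j - b) * F z η := le_trans (by positivity) h1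
    by_contra hneg
    push Not at hneg
    nlinarith
  let ℓ : Site N × Config N → (Config N → ℝ) →L[ℝ] ℝ := fun i =>
    ContinuousLinearMap.proj (R := ℝ) (φ := fun _ : Config N => ℝ) (Function.update i.2 i.1 true)
      - ContinuousLinearMap.proj (R := ℝ) (φ := fun _ : Config N => ℝ)
        (Function.update i.2 i.1 false)
  have hℓ : ∀ i f, ℓ i f = grad f i.1 i.2 := fun i f => rfl
  have key := abs_exp_smul_apply_le (shiftedGenerator N j) ℓ (fun i => F i.1 i.2) hr (by
    intro f A hA hf i
    rw [hℓ, shiftedGenerator_apply]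
    exact abs_grad_shifted_generator_le hN hj hA hsymm rfl hF (fun z η => hf (z, η)) i.1 i.2)
    ht hA (f := f) (fun i => hf i.1 i.2) (z, η)
  rw [hℓ] at key
  have e : grad (semigroup N j t f) z η =
      Real.exp (-(totalRate N j * t)) *
        grad (NormedSpace.exp (t • shiftedGenerator N j) f) z η := by
    simp [semigroup_eq, grad, mul_sub]
  rw [e, abs_mul, abs_of_pos (Real.exp_pos _)]
  calc _ ≤ Real.exp (-(totalRate N j * t)) *
        (Real.exp (t * (totalRate N j - b)) * A * F z η) :=
        mul_le_mul_of_nonneg_left key (Real.exp_pos _).le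
    _ = _ := by
        rw [← mul_assoc, ← mul_assoc, ← Real.exp_add]
        congr 3; ring

theorem tvNorm_law_sub_law_le (hN : 1 ≤ N) (hj : 0 ≤ j)
    (hsymm : ∀ z η, F (negSite z) (refl η) = F z η) (hpos : ∀ z η, 1 / 2 ≤ F z η)
    (hle : ∀ z η, F z η ≤ 1)
    (hF : ∀ z η, 1 / 2 * ∑ p ∈ bonds N, F (Equiv.swap p.1 p.2 z) (exchange η p.1 p.2)
      + j / (2 * (N : ℝ)) * rightVal hN F z η
      + j / (2 * (N : ℝ)) * rightVal hN F (negSite z) (refl η) ≤ (totalRate N j - b) * F z η)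
    {μ ν : Config N → ℝ} (hμ : IsProb μ) (hν : IsProb ν) {t : ℝ} (ht : 0 ≤ t) :
    tvNorm (law N j t μ - law N j t ν) ≤ 12 * N * Real.exp (-(b * t)) := by
  -- The sign of the difference is the test function that attains the norm.
  let s : Config N → ℝ := fun η => if 0 ≤ (law N j t μ - law N j t ν) η then 1 else -1
  have e : tvNorm (law N j t μ - law N j t ν) =
      expect μ (semigroup N j t s) - expect ν (semigroup N j t s) := by
    rw [← expect_law, ← expect_law, expect, expect, ← Finset.sum_sub_distrib, tvNorm]
    refine Finset.sum_congr rfl fun η _ => ?_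
    rw [← sub_mul]
    change |(law N j t μ - law N j t ν) η| = (law N j t μ - law N j t ν) η * s η
    by_cases h : 0 ≤ (law N j t μ - law N j t ν) η
    · simp only [s, if_pos h, mul_one, abs_of_nonneg h]
    · simp only [s, if_neg h, abs_of_neg (not_le.mp h)]; ring
  -- A gradient of a sign function is at most 2, and F is at least 1/2.
  have hs : ∀ z η, |grad s z η| ≤ 4 * F z η := by
    intro z η
    have h1 : ∀ ξ, |s ξ| ≤ 1 := by
      intro ξ
      by_cases h : 0 ≤ (law N j t μ - law N j t ν) ξ
      · simp only [s, if_pos h, abs_one, le_refl]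
      · simp only [s, if_neg h, abs_neg, abs_one, le_refl]
    have h2 := abs_sub (s (Function.update η z true)) (s (Function.update η z false))
    have h3 := h1 (Function.update η z true)
    have h4 := h1 (Function.update η z false)
    have h5 := hpos z η
    unfold grad
    linarith
  have hg : ∀ z η, |grad (semigroup N j t s) z η| ≤ Real.exp (-(b * t)) * 4 := by
    intro z η
    have h1 := abs_grad_semigroup_le hN hj hsymm hpos hF (by norm_num) ht hs z η
    have h2 := hle z η
    have h3 : 0 < Real.exp (-(b * t)) := Real.exp_pos _
    nlinarith
  rw [e]
  refine (expect_sub_expect_le hμ hν fun η ξ =>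
    (le_abs_self _).trans (abs_sub_le_of_abs_grad_le hg η ξ)).trans ?_
  have h3 : 0 < Real.exp (-(b * t)) := Real.exp_pos _
  have h4 : (1 : ℝ) ≤ N := by exact_mod_cast hN
  nlinarith

/-- A function `F` which decays at rate `b` along the motion of a single discrepancy forces
exponential convergence to a unique stationary measure. -/
theorem exists_stationary_of_decay (hN : 1 ≤ N) (hj : 0 ≤ j) (hb : 0 < b)
    (hsymm : ∀ z η, F (negSite z) (refl η) = F z η) (hpos : ∀ z η, 1 / 2 ≤ F z η)
    (hle : ∀ z η, F z η ≤ 1)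
    (hF : ∀ z η, 1 / 2 * ∑ p ∈ bonds N, F (Equiv.swap p.1 p.2 z) (exchange η p.1 p.2)
      + j / (2 * (N : ℝ)) * rightVal hN F z η
      + j / (2 * (N : ℝ)) * rightVal hN F (negSite z) (refl η) ≤ (totalRate N j - b) * F z η) :
    ∃ μst : Config N → ℝ, IsStationary N j μst ∧ (∀ ν, IsStationary N j ν → ν = μst) ∧
      ∀ μ : Config N → ℝ, IsProb μ → ∀ t : ℝ, 0 < t →
        tvNorm (law N j t μ - μst) ≤ 12 * N * Real.exp (-(b * t)) := by
  have contr : ∀ {μ ν : Config N → ℝ}, IsProb μ → IsProb ν → ∀ {t : ℝ}, 0 ≤ t →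
      tvNorm (law N j t μ - law N j t ν) ≤ 12 * N * Real.exp (-(b * t)) :=
    fun hμ hν _ ht => tvNorm_law_sub_law_le hN hj hsymm hpos hle hF hμ hν ht
  have hexp : ∀ n : ℕ, Real.exp (-(b * n)) = Real.exp (-b) ^ n := by
    intro n; rw [← Real.exp_nat_mul]; congr 1; ring
  have hr1 : Real.exp (-b) < 1 := by simpa using hb
  have hlim : Tendsto (fun n : ℕ => 12 * (N : ℝ) * Real.exp (-b) ^ n) atTop (𝓝 0) := by
    simpa using (tendsto_pow_atTop_nhds_zero_of_lt_one (Real.exp_pos _).le hr1).const_mul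
      (12 * (N : ℝ))
  let μ₀ : Config N → ℝ := Pi.single (fun _ => true) 1
  have hμ₀ : IsProb μ₀ := by
    constructor
    · intro η
      by_cases h : η = fun _ => true
      · subst h; simp [μ₀]
      · simp [μ₀, h]
    · simp [μ₀]
  let u : ℕ → Config N → ℝ := fun n => law N j n μ₀
  have hu : ∀ n, IsProb (u n) := fun n => isProb_law hN hj n.cast_nonneg hμ₀
  -- Both laws result from running the process for time n, from μ₀ and from its law at time t, so
  -- the contraction applies. The case t = 1 gives the Cauchy property, general t the stationarity
  -- of the limit.
  have hdist : ∀ (t : ℝ), 0 ≤ t → ∀ n, dist (u n) (law N j t (u n)) ≤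
      12 * N * Real.exp (-b) ^ n := by
    intro t ht n
    refine (dist_le_tvNorm _ _).trans ?_
    rw [law_law, add_comm, ← law_law, ← hexp]
    exact contr hμ₀ (isProb_law hN hj ht hμ₀) n.cast_nonneg
  have hcauchy : CauchySeq u := by
    refine cauchySeq_of_le_geometric _ (12 * (N : ℝ)) hr1 fun n => ?_
    have := hdist 1 zero_le_one n
    rw [law_law] at this
    simpa [u] using this
  obtain ⟨π, hπ⟩ := cauchySeq_tendsto_of_complete hcauchy
  have hπ' : ∀ η, Tendsto (fun n => u n η) atTop (𝓝 (π η)) := tendsto_pi_nhds.mp hπ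
  have hprob : IsProb π := by
    refine ⟨fun η => ge_of_tendsto' (hπ' η) fun n => (hu n).1 η, ?_⟩
    have h1 := tendsto_finsetSum Finset.univ fun η _ => hπ' η
    simp only [(hu _).2] at h1
    exact tendsto_nhds_unique h1 tendsto_const_nhds
  have hst : IsStationary N j π := by
    refine ⟨hprob, fun t ht => ?_⟩
    have h1 : Tendsto (fun n => law N j t (u n)) atTop (𝓝 (law N j t π)) :=
      ((continuous_law j t).tendsto π).comp hπ
    have h2 : Tendsto (fun n => dist (u n) (law N j t (u n))) atTop (𝓝 (dist π (law N j t π))) :=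
      hπ.dist h1
    have h3 : dist π (law N j t π) ≤ 0 := le_of_tendsto_of_tendsto' h2 hlim (hdist t ht)
    exact (dist_le_zero.mp h3).symm
  have hconv : ∀ μ : Config N → ℝ, IsProb μ → ∀ t : ℝ, 0 < t →
      tvNorm (law N j t μ - π) ≤ 12 * N * Real.exp (-(b * t)) := by
    intro μ hμ t ht
    conv_lhs => rw [← hst.2 t ht.le]
    exact contr hμ hprob ht.le
  refine ⟨π, hst, fun ν hν => ?_, hconv⟩
  have h1 : ∀ n : ℕ, dist ν π ≤ 12 * N * Real.exp (-b) ^ n := by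
    intro n
    have h2 := contr hν.1 hprob (t := n) n.cast_nonneg
    rw [hν.2 _ n.cast_nonneg, hst.2 _ n.cast_nonneg, hexp] at h2
    exact (dist_le_tvNorm _ _).trans h2
  exact dist_le_zero.mp (ge_of_tendsto' hlim h1)

end Decay

end CurrentReservoir

/-! ### Reduction to weights on pairs of sites -/

namespace CurrentReservoir

variable {N : ℕ}

/-- The generator of the stirring motion of a pair of sites. -/
def pairGen (N : ℕ) (B : ℤ → ℤ → ℝ) (z y : ℤ) : ℝ :=
  1 / 2 * ∑ x ∈ Finset.Ico (-(N : ℤ)) N,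
    (B (Equiv.swap x (x + 1) z) (Equiv.swap x (x + 1) y) - B z y)

/-- The loss in `B z y` when a discrepancy at `z = N` is pushed to `N - 1`. -/
def pushLoss (N : ℕ) (B : ℤ → ℤ → ℝ) (z y : ℤ) : ℝ :=
  if z = N ∧ y < N - 1 then B N y - B (N - 1) y else 0

/-- An upper bound for the loss in `B z y` due to deaths at the left end. -/
def deathLoss (N : ℕ) (B : ℤ → ℤ → ℝ) (z y : ℤ) : ℝ :=
  if min z y ≤ -(N : ℤ) + 1 then B z y else 0

/-- The pair occupies the two sites at the right end, where a discrepancy disappears. -/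
def cornerGain (N : ℕ) (z y : ℤ) : ℝ :=
  if (z = N ∧ y = N - 1) ∨ (z = N - 1 ∧ y = N) then 1 / 2 else 0

/-- Weights `B z y` such that `∑_y η(y) B(z,y)` bounds from below the probability that a
discrepancy at `z` disappears at the right end by meeting a particle. -/
structure IsPairWeight (N : ℕ) (ε β : ℝ) (B : ℤ → ℤ → ℝ) : Prop where
  diag : ∀ x, B x x = 0
  nonneg : ∀ x y, 0 ≤ B x y
  push : ∀ y : ℤ, -(N : ℤ) ≤ y → y < N - 1 → B (N - 1) y ≤ B N y
  sum_le : ∀ z ∈ Finset.Icc (-(N : ℤ)) N, ∑ y ∈ Finset.Icc (-(N : ℤ)) N, B z y ≤ 1 / 4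
  gen : ∀ z ∈ Finset.Icc (-(N : ℤ)) N, ∀ y ∈ Finset.Icc (-(N : ℤ)) N, z ≠ y →
    β + ε * pushLoss N B z y + ε * deathLoss N B z y ≤ pairGen N B z y + ε * cornerGain N z y

/-- `∑_y η(y) B(z,y)`. -/
def weightSum (B : ℤ → ℤ → ℝ) (z : Site N) (η : Config N) : ℝ := ∑ y : Site N, occ η y * B z y

/-- The function which decays along the motion of a discrepancy. -/
def decayFun (B : ℤ → ℤ → ℝ) (z : Site N) (η : Config N) : ℝ :=
  1 - weightSum B z η - weightSum B (negSite z) (refl η)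

theorem decayFun_symm (B : ℤ → ℤ → ℝ) (z : Site N) (η : Config N) :
    decayFun B (negSite z) (refl η) = decayFun B z η := by
  simp only [decayFun, negSite_negSite, refl_refl]; ring

theorem occ_nonneg (η : Config N) (x : Site N) : 0 ≤ occ η x := by
  unfold occ; split_ifs <;> norm_num

theorem occ_le_one (η : Config N) (x : Site N) : occ η x ≤ 1 := by
  unfold occ; split_ifs <;> norm_num

theorem swap_coe (x y z : Site N) :
    ((Equiv.swap x y z : Site N) : ℤ) = Equiv.swap (x : ℤ) (y : ℤ) (z : ℤ) :=
  (Function.Injective.swap_apply Subtype.val_injective x y z).symm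

theorem sum_bonds (h : ℤ → ℤ → ℝ) :
    ∑ p ∈ bonds N, h p.1 p.2 = ∑ x ∈ Finset.Ico (-(N : ℤ)) N, h x (x + 1) := by
  refine Finset.sum_bij (fun p _ => (p.1 : ℤ)) ?_ ?_ ?_ ?_
  · intro p hp
    simp only [bonds, Finset.mem_filter, Finset.mem_univ, true_and] at hp
    have h1 := neg_le_coe p.1
    have h2 := le_top p.2
    simp only [Finset.mem_Ico]; omega
  · rintro ⟨a, b⟩ hp ⟨c, d⟩ hq h
    simp only [bonds, Finset.mem_filter, Finset.mem_univ, true_and] at hp hq h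
    simp only [Prod.mk.injEq, Subtype.ext_iff]; omega
  · intro x hx
    simp only [Finset.mem_Ico] at hx
    refine ⟨(⟨x, by simp; omega⟩, ⟨x + 1, by simp; omega⟩), by simp [bonds], rfl⟩
  · intro p hp
    simp only [bonds, Finset.mem_filter, Finset.mem_univ, true_and] at hp
    rw [hp]

theorem weightSum_exchange (B : ℤ → ℤ → ℝ) (p : Site N × Site N) (z : Site N) (η : Config N) :
    weightSum B (Equiv.swap p.1 p.2 z) (exchange η p.1 p.2) =
      ∑ y : Site N, occ η y *
        B (Equiv.swap (p.1 : ℤ) p.2 z) (Equiv.swap (p.1 : ℤ) p.2 y) := by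
  rw [weightSum, ← Equiv.sum_comp (Equiv.swap p.1 p.2)]
  refine Finset.sum_congr rfl fun y _ => ?_
  rw [swap_coe, swap_coe]
  simp [occ, exchange]

/-- Self-duality of stirring: after relabelling the particles, each exchange moves the pair (z, y)
and leaves the occupation factor alone. -/
theorem sum_bonds_weightSum (B : ℤ → ℤ → ℝ) (z : Site N) (η : Config N) :
    1 / 2 * ∑ p ∈ bonds N, weightSum B (Equiv.swap p.1 p.2 z) (exchange η p.1 p.2) =
      1 / 2 * (bonds N).card * weightSum B z η + ∑ y : Site N, occ η y * pairGen N B z y := by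
  have hc : ((bonds N).card : ℝ) = ∑ x ∈ Finset.Ico (-(N : ℤ)) N, (1 : ℝ) := by
    rw [← sum_bonds (N := N) fun _ _ => 1]; simp
  simp only [weightSum_exchange]
  rw [Finset.sum_comm, weightSum, Finset.mul_sum, Finset.mul_sum, ← Finset.sum_add_distrib]
  refine Finset.sum_congr rfl fun y _ => ?_
  rw [sum_bonds (fun a b => occ η y * B (Equiv.swap a b z) (Equiv.swap a b y)), hc, pairGen,
    Finset.sum_sub_distrib, ← Finset.mul_sum, Finset.sum_const, Finset.sum_const,
    nsmul_eq_mul, nsmul_eq_mul]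
  ring

theorem negSite_swap (x y z : Site N) :
    negSite (Equiv.swap x y z) = Equiv.swap (negSite x) (negSite y) (negSite z) :=
  (Function.Injective.swap_apply (negEquiv N).injective x y z).symm

theorem refl_exchange (η : Config N) (x y : Site N) :
    refl (exchange η x y) = exchange (refl η) (negSite x) (negSite y) := by
  funext z
  simp only [refl, exchange]
  rw [negSite_swap, negSite_negSite, negSite_negSite]

theorem sum_bonds_negSite (h : Site N → Site N → ℝ) :
    ∑ p ∈ bonds N, h (negSite p.2) (negSite p.1) = ∑ p ∈ bonds N, h p.1 p.2 := by
  refine Finset.sum_bij (fun p _ => (negSite p.2, negSite p.1)) ?_ ?_ ?_ ?_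
  · intro p hp
    simp only [bonds, Finset.mem_filter, Finset.mem_univ, true_and, coe_negSite] at *
    omega
  · rintro ⟨a, b⟩ _ ⟨c, d⟩ _ h
    simp only [Prod.mk.injEq, negSite_inj] at h ⊢
    exact h.symm
  · intro p hp
    refine ⟨(negSite p.2, negSite p.1), ?_, by simp⟩
    simp only [bonds, Finset.mem_filter, Finset.mem_univ, true_and, coe_negSite] at *
    omega
  · intro p _; rfl

theorem sum_bonds_weightSum_refl (B : ℤ → ℤ → ℝ) (z : Site N) (η : Config N) :
    ∑ p ∈ bonds N, weightSum B (negSite (Equiv.swap p.1 p.2 z)) (refl (exchange η p.1 p.2)) =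
    ∑ p ∈ bonds N, weightSum B (Equiv.swap p.1 p.2 (negSite z)) (exchange (refl η) p.1 p.2) := by
  rw [← sum_bonds_negSite fun x y => weightSum B (Equiv.swap x y (negSite z))
    (exchange (refl η) x y)]
  refine Finset.sum_congr rfl fun p _ => ?_
  rw [negSite_swap, refl_exchange, Equiv.swap_comm]
  congr 1
  funext x
  simp only [exchange]
  rw [Equiv.swap_comm]

theorem occ_update_true (η : Config N) (x y : Site N) :
    occ η y ≤ occ (Function.update η x true) y := by
  by_cases h : y = x
  · subst h; simpa [occ] using occ_le_one η y
  · simp [occ, h]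

theorem occ_fill (hN : 1 ≤ N) (η : Config N) (y : Site N) : occ η y ≤ occ (fill hN η) y := by
  unfold fill
  split_ifs <;> exact occ_update_true _ _ _

theorem fill_apply_of_lt (hN : 1 ≤ N) (η : Config N) {y : Site N} (hy : (y : ℤ) < N - 1) :
    fill hN η y = η y := by
  have h1 : y ≠ top N := by rintro rfl; simp at hy; omega
  have h2 : y ≠ subTop hN := by rintro rfl; simp at hy
  unfold fill
  split_ifs <;> simp [h1, h2]

section Weight

variable {ε β : ℝ} {B : ℤ → ℤ → ℝ}

theorem weightSum_nonneg (hB : IsPairWeight N ε β B) (z : Site N) (η : Config N) :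
    0 ≤ weightSum B z η :=
  Finset.sum_nonneg fun y _ => mul_nonneg (occ_nonneg η y) (hB.nonneg _ _)

theorem weightSum_le (hB : IsPairWeight N ε β B) (z : Site N) (η : Config N) :
    weightSum B z η ≤ 1 / 4 := by
  refine le_trans ?_ (hB.sum_le z z.2)
  rw [← Finset.sum_coe_sort (Finset.Icc (-(N : ℤ)) N)]
  exact Finset.sum_le_sum fun y _ => mul_le_of_le_one_left (hB.nonneg _ _) (occ_le_one η y)

theorem half_le_decayFun (hB : IsPairWeight N ε β B) (z : Site N) (η : Config N) :
    1 / 2 ≤ decayFun B z η := by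
  have h1 := weightSum_le hB z η
  have h2 := weightSum_le hB (negSite z) (refl η)
  unfold decayFun; linarith

theorem decayFun_le_one (hB : IsPairWeight N ε β B) (z : Site N) (η : Config N) :
    decayFun B z η ≤ 1 := by
  have h1 := weightSum_nonneg hB z η
  have h2 := weightSum_nonneg hB (negSite z) (refl η)
  unfold decayFun; linarith

/-- `∑_y η(y) G(z,y)`, with `G` any of the losses and gains, is additive in `G`. -/
theorem weightSum_sub (G H : ℤ → ℤ → ℝ) (z : Site N) (η : Config N) :
    weightSum (fun x y => G x y - H x y) z η = weightSum G z η - weightSum H z η := by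
  simp [weightSum, mul_sub]

/-- The push is harmful only through particles left of N-1: N-1 is empty, and y = N has weight 0 on
the left because B vanishes on the diagonal. -/
theorem weightSum_le_of_push (hN : 1 ≤ N) (hB : IsPairWeight N ε β B) {η : Config N}
    (hη : η (subTop hN) = false) :
    weightSum B (top N) η - weightSum (pushLoss N B) (top N) η ≤
      weightSum B (subTop hN) (Function.update η (top N) true) := by
  rw [← weightSum_sub]
  refine Finset.sum_le_sum fun y _ => ?_
  have hpos : 0 ≤ occ (Function.update η (top N) true) y * B (subTop hN : Site N) y :=
    mul_nonneg (occ_nonneg _ _) (hB.nonneg _ _)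
  by_cases h1 : y = top N
  · subst h1
    simpa [pushLoss, hB.diag, show ¬ ((N : ℤ) < N - 1) by omega] using hpos
  by_cases h2 : y = subTop hN
  · subst h2
    have : occ η (subTop hN) = 0 := by simp [occ, hη]
    rw [this]; simpa using hpos
  · have hlt : (y : ℤ) < N - 1 := by
      have := le_top y
      simp only [Subtype.ext_iff, coe_top, coe_subTop] at h1 h2
      omega
    simp [pushLoss, hlt, occ, h1]

theorem weightSum_sub_deathLoss_nonpos {z : Site N} (hz : (z : ℤ) ≤ -N + 1) (η : Config N) :
    weightSum B z η - weightSum (deathLoss N B) z η = 0 := by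
  rw [← weightSum_sub]
  refine Finset.sum_eq_zero fun y _ => ?_
  simp only [deathLoss, if_pos (min_le_of_left_le hz), sub_self, mul_zero]

/-- A birth removes a hole at the right end, which in the reflected picture is the death of a
particle in {-N, -N+1}; all weights involving these two sites are given up. -/
theorem weightSum_refl_fill (hN : 1 ≤ N) (hB : IsPairWeight N ε β B) (z : Site N) (η : Config N) :
    weightSum B z (refl η) - weightSum (deathLoss N B) z (refl η) ≤
      weightSum B z (refl (fill hN η)) := by
  rw [← weightSum_sub]
  refine Finset.sum_le_sum fun y _ => ?_
  by_cases h : min (z : ℤ) y ≤ -N + 1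
  · simpa [deathLoss, h] using mul_nonneg (occ_nonneg _ _) (hB.nonneg z y)
  · have h' : ((negSite y : Site N) : ℤ) < N - 1 := by
      simp only [coe_negSite]; omega
    simp only [deathLoss, h, if_false, sub_zero, occ_refl]
    simp only [occ, fill_apply_of_lt hN η h', le_refl]

theorem pushLoss_nonneg (hB : IsPairWeight N ε β B) (z y : Site N) :
    0 ≤ pushLoss N B z y := by
  unfold pushLoss
  split_ifs with h
  · have := hB.push y (neg_le_coe y) h.2; linarith
  · exact le_rfl

theorem deathLoss_nonneg (hB : IsPairWeight N ε β B) (z y : Site N) :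
    0 ≤ deathLoss N B z y := by
  unfold deathLoss
  split_ifs with h
  · exact hB.nonneg _ _
  · exact le_rfl

theorem weightSum_cornerGain_eq_zero {z : Site N} {η : Config N}
    (h : ∀ y : Site N, η y = true → cornerGain N z y = 0) :
    weightSum (cornerGain N) z η = 0 := by
  refine Finset.sum_eq_zero fun y _ => ?_
  by_cases hy : η y = true
  · simp [h y hy]
  · simp [occ, hy]

theorem weightSum_cornerGain_le (hN : 1 ≤ N) (z : Site N) (η : Config N) :
    weightSum (cornerGain N) z η ≤ 1 / 2 := by
  let w : Site N := if z = top N then subTop hN else top N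
  have hw : ∀ y : Site N, occ η y * cornerGain N z y ≤ if y = w then 1 / 2 else 0 := by
    intro y
    have h0 : occ η y * cornerGain N z y ≤ cornerGain N z y := by
      refine mul_le_of_le_one_left ?_ (occ_le_one η y)
      unfold cornerGain; split_ifs <;> norm_num
    refine h0.trans ?_
    unfold cornerGain
    split_ifs with h1 h2
    · exact le_rfl
    · exfalso
      apply h2
      simp only [w]
      split_ifs with h3 <;> simp only [Subtype.ext_iff, coe_top, coe_subTop] at h3 ⊢ <;> omega
    · norm_num
    · exact le_rfl
  refine (Finset.sum_le_sum fun y _ => hw y).trans ?_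
  simp

/-- When the discrepancy disappears the new value is 0 and the old one at least 1/2, which pays for
a corner gain of 1/2. In the other cases the corner gain vanishes, and only the push and the lost
hole can raise F. -/
theorem rightVal_decayFun_le (hN : 1 ≤ N) (hB : IsPairWeight N ε β B) (z : Site N)
    (η : Config N) :
    rightVal hN (decayFun B) z η ≤ decayFun B z η + weightSum (pushLoss N B) z η
      + weightSum (deathLoss N B) (negSite z) (refl η) - weightSum (cornerGain N) z η := by
  have hp : 0 ≤ weightSum (pushLoss N B) z η :=
    Finset.sum_nonneg fun y _ => mul_nonneg (occ_nonneg _ _) (pushLoss_nonneg hB _ _)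
  have hd : 0 ≤ weightSum (deathLoss N B) (negSite z) (refl η) :=
    Finset.sum_nonneg fun y _ => mul_nonneg (occ_nonneg _ _) (deathLoss_nonneg hB _ _)
  have hkill : 0 ≤ decayFun B z η + weightSum (pushLoss N B) z η
      + weightSum (deathLoss N B) (negSite z) (refl η) - weightSum (cornerGain N) z η := by
    have h1 := half_le_decayFun hB z η
    have h2 := weightSum_cornerGain_le hN z η
    linarith
  unfold rightVal
  split_ifs with h1 h2 h3 h4
  · exact hkill
  · subst h1
    have e1 := weightSum_le_of_push hN hB (η := η) (by simpa using h2)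
    have e2 := weightSum_sub_deathLoss_nonpos (B := B) (z := negSite (top N)) (by simp) (refl η)
    have e3 := weightSum_nonneg hB (negSite (subTop hN)) (refl (Function.update η (top N) true))
    have e4 : weightSum (cornerGain N) (top N) η = 0 := by
      refine weightSum_cornerGain_eq_zero fun y hy => if_neg ?_
      rintro (⟨_, h⟩ | ⟨h, _⟩)
      · exact h2 ((show y = subTop hN from Subtype.ext h) ▸ hy)
      · simp only [coe_top] at h; omega
    unfold decayFun
    linarith
  · exact hkill
  · subst h3
    have e1 : weightSum B (subTop hN) η ≤
        weightSum B (subTop hN) (Function.update η (top N) true) :=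
      Finset.sum_le_sum fun y _ =>
        mul_le_mul_of_nonneg_right (occ_update_true _ _ _) (hB.nonneg _ _)
    have e2 := weightSum_sub_deathLoss_nonpos (B := B) (z := negSite (subTop hN))
      (by simp) (refl η)
    have e3 := weightSum_nonneg hB (negSite (subTop hN)) (refl (Function.update η (top N) true))
    have e4 : weightSum (cornerGain N) (subTop hN) η = 0 := by
      refine weightSum_cornerGain_eq_zero fun y hy => if_neg ?_
      rintro (⟨h, _⟩ | ⟨_, h⟩)
      · simp at h
      · exact h4 ((show y = top N from Subtype.ext h) ▸ hy)
    unfold decayFun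
    linarith
  · have e1 : weightSum B z η ≤ weightSum B z (fill hN η) :=
      Finset.sum_le_sum fun y _ => mul_le_mul_of_nonneg_right (occ_fill hN _ _) (hB.nonneg _ _)
    have e2 := weightSum_refl_fill hN hB (negSite z) η
    have e4 : weightSum (cornerGain N) z η = 0 := by
      refine weightSum_cornerGain_eq_zero fun y hy => if_neg ?_
      rintro (⟨h, _⟩ | ⟨h, _⟩)
      · exact h1 (Subtype.ext h)
      · exact h3 (Subtype.ext h)
    unfold decayFun
    linarith

/-- The pair inequality is summed over the particles y ≠ z; the diagonal terms vanish. -/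
theorem weightSum_gen_le (hB : IsPairWeight N ε β B) (z : Site N) (η : Config N) :
    β * ∑ y ∈ Finset.univ.erase z, occ η y + ε * weightSum (pushLoss N B) z η
      + ε * weightSum (deathLoss N B) z η ≤
    ∑ y : Site N, occ η y * pairGen N B z y + ε * weightSum (cornerGain N) z η := by
  have hz : ∀ G : ℤ → ℤ → ℝ, G z z = 0 →
      weightSum G z η = ∑ y ∈ Finset.univ.erase z, occ η y * G z y := by
    intro G hG
    rw [weightSum, ← Finset.add_sum_erase _ _ (Finset.mem_univ z), hG, mul_zero, zero_add]
  rw [hz (pushLoss N B) (if_neg (by omega)), hz (deathLoss N B) (by simp [deathLoss, hB.diag]),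
    hz (cornerGain N) (if_neg (by omega))]
  have := hz (pairGen N B) (by simp [pairGen, hB.diag])
  rw [weightSum] at this
  rw [this]
  simp only [Finset.mul_sum, ← Finset.sum_add_distrib]
  refine Finset.sum_le_sum fun y hy => ?_
  have hne : (z : ℤ) ≠ y := fun h => (Finset.ne_of_mem_erase hy) (Subtype.ext h.symm)
  have h1 := mul_le_mul_of_nonneg_left (hB.gen z z.2 y y.2 hne) (occ_nonneg η y)
  linarith

theorem sum_occ_add_sum_occ_refl (z : Site N) (η : Config N) :
    ∑ y ∈ Finset.univ.erase z, occ η y +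
      ∑ y ∈ Finset.univ.erase (negSite z), occ (refl η) y = 2 * N := by
  have e : ∑ y ∈ Finset.univ.erase (negSite z), occ (refl η) y =
      ∑ y ∈ Finset.univ.erase z, (1 - occ η y) := by
    refine Finset.sum_bij (fun y _ => negSite y) ?_ ?_ ?_ ?_
    · intro y hy
      simp only [Finset.mem_erase, Finset.mem_univ, and_true] at *
      rintro rfl; simp at hy
    · intro a _ b _ h; simpa using h
    · intro y hy
      refine ⟨negSite y, ?_, by simp⟩
      simpa using hy
    · intro y _; rw [occ_refl]
  rw [e, ← Finset.sum_add_distrib]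
  simp only [add_sub_cancel, Finset.sum_const, nsmul_eq_mul, mul_one]
  rw [Finset.card_erase_of_mem (Finset.mem_univ z), Finset.card_univ, Fintype.card_coe,
    Int.card_Icc]
  have : ((N : ℤ) + 1 - -(N : ℤ)).toNat - 1 = 2 * N := by omega
  rw [this]; push_cast; ring

/-- Pair weights give exponential convergence to the stationary measure. -/
theorem exists_stationary_of_isPairWeight (hN : 1 ≤ N) {j : ℝ} (hj : 0 ≤ j) (hβ : 0 < β)
    (hε : ε = j / (2 * (N : ℝ))) (hB : IsPairWeight N ε β B) :
    ∃ μst : Config N → ℝ, IsStationary N j μst ∧ (∀ ν, IsStationary N j ν → ν = μst) ∧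
      ∀ μ : Config N → ℝ, IsProb μ → ∀ t : ℝ, 0 < t →
        tvNorm (law N j t μ - μst) ≤ 12 * N * Real.exp (-(2 * N * β * t)) := by
  have hN' : (0 : ℝ) < N := by exact_mod_cast hN
  refine exists_stationary_of_decay (F := decayFun B) hN hj (by positivity) (decayFun_symm B)
    (half_le_decayFun hB) (decayFun_le_one hB) fun z η => ?_
  have hε0 : 0 ≤ ε := by rw [hε]; positivity
  rw [totalRate, ← hε]
  have e1 := sum_bonds_weightSum B z η
  have e2 := sum_bonds_weightSum B (negSite z) (refl η)
  have e3 := sum_bonds_weightSum_refl B z η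
  have e4 : ∑ p ∈ bonds N, decayFun B (Equiv.swap p.1 p.2 z) (exchange η p.1 p.2) =
      (bonds N).card - ∑ p ∈ bonds N, weightSum B (Equiv.swap p.1 p.2 z) (exchange η p.1 p.2)
      - ∑ p ∈ bonds N, weightSum B (Equiv.swap p.1 p.2 (negSite z))
        (exchange (refl η) p.1 p.2) := by
    rw [← e3]
    simp [decayFun, Finset.sum_sub_distrib]
  have g1 := weightSum_gen_le hB z η
  have g2 := weightSum_gen_le hB (negSite z) (refl η)
  have r1 := mul_le_mul_of_nonneg_left (rightVal_decayFun_le hN hB z η) hε0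
  have r2 := mul_le_mul_of_nonneg_left (rightVal_decayFun_le hN hB (negSite z) (refl η)) hε0
  rw [negSite_negSite, refl_refl, decayFun_symm] at r2
  -- Particles and holes together supply the gain 2Nβ, which dominates 2NβF since F ≤ 1.
  have s := congrArg (β * ·) (sum_occ_add_sum_occ_refl z η)
  simp only [mul_add] at s
  have h1 := decayFun_le_one hB z η
  have h2 : 2 * N * β * decayFun B z η ≤ 2 * N * β := mul_le_of_le_one_right (by positivity) h1
  have e5 : 1 / 2 * ∑ p ∈ bonds N, decayFun B (Equiv.swap p.1 p.2 z) (exchange η p.1 p.2) =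
      1 / 2 * (bonds N).card * decayFun B z η - ∑ y : Site N, occ η y * pairGen N B z y
      - ∑ y : Site N, occ (refl η) y * pairGen N B (negSite z) y := by
    rw [e4, mul_sub, mul_sub, e1, e2, decayFun]; ring
  rw [e5]
  linarith

end Weight

end CurrentReservoir

/-! ### Pairs of sites as a reflected walk on a planar grid -/

namespace CurrentReservoir

variable {N : ℕ}

/-- The pair weight given by a function on the grid `[0, 2N-1]²`: the pair `y < z` is placed at
`(N - z, N - 1 - y)`. -/
def pairOfGrid (N : ℕ) (P : ℤ → ℤ → ℝ) (z y : ℤ) : ℝ :=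
  if z = y then 0 else P (N - max z y) (N - 1 - min z y)

/-- The discrete Laplacian. -/
def gridLap (P : ℤ → ℤ → ℝ) (a b : ℤ) : ℝ :=
  P (a - 1) b + P (a + 1) b + P a (b - 1) + P a (b + 1) - 4 * P a b

/-- Functions on the grid `[0, 2N-1]²`, extended by reflection, which give pair weights. -/
structure IsGridWeight (N : ℕ) (ε β : ℝ) (P : ℤ → ℤ → ℝ) : Prop where
  symm : ∀ a b, P a b = P b a
  nonneg : ∀ a b, 0 ≤ P a b
  reflect_left : ∀ b, P (-1) b = P 0 b
  reflect_right : ∀ b, P (2 * N) b = P (2 * N - 1) b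
  anti : ∀ b : ℤ, 1 ≤ b → b ≤ 2 * N - 1 → P 1 b ≤ P 0 b
  -- The corner is the pair at N and N-1. The conditional term matters for N = 1 only, where this
  -- pair also touches the left end.
  corner : β + ε * (if 2 * (N : ℤ) - 2 ≤ 0 then P 0 0 else 0) ≤ 1 / 2 * (P 0 1 - P 0 0) + ε / 2
  gen : ∀ a b : ℤ, 0 ≤ a → a ≤ b → 1 ≤ b → b ≤ 2 * N - 1 →
    β + ε * (if a = 0 then P 0 b - P 1 b else 0) + ε * (if 2 * (N : ℤ) - 2 ≤ b then P a b else 0)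
      ≤ 1 / 4 * gridLap P a b
  sum_le : ∃ h : ℤ → ℝ, (∀ a b : ℤ, 0 ≤ a → 0 ≤ b → b ≤ 2 * N - 1 → P a b ≤ h b) ∧
    (∀ b : ℤ, 0 ≤ b → b ≤ 2 * N - 1 → 0 ≤ h b) ∧ ∑ c ∈ Finset.Icc (0 : ℤ) (2 * N - 1), h c ≤ 1 / 8

theorem pairOfGrid_comm (P : ℤ → ℤ → ℝ) (z y : ℤ) : pairOfGrid N P z y = pairOfGrid N P y z := by
  simp only [pairOfGrid, max_comm z y, min_comm z y, eq_comm]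

theorem pairOfGrid_of_lt (P : ℤ → ℤ → ℝ) {z y : ℤ} (h : y < z) :
    pairOfGrid N P z y = P (N - z) (N - 1 - y) := by
  rw [pairOfGrid, if_neg h.ne', max_eq_left h.le, min_eq_right h.le]

theorem pairGen_comm {B : ℤ → ℤ → ℝ} (hB : ∀ z y, B z y = B y z) (z y : ℤ) :
    pairGen N B z y = pairGen N B y z := by
  unfold pairGen
  congr 1
  exact Finset.sum_congr rfl fun x _ => by rw [hB, hB z y]

theorem pairGen_of_gap {B : ℤ → ℤ → ℝ} {z y : ℤ} (hy : -(N : ℤ) ≤ y) (hz : z ≤ N)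
    (h : y + 1 < z) :
    pairGen N B z y = 1 / 2 * ((if z < N then B (z + 1) y - B z y else 0) +
      (if -(N : ℤ) < y then B z (y - 1) - B z y else 0) + (B (z - 1) y - B z y) +
      (B z (y + 1) - B z y)) := by
  have e : ∀ x : ℤ, B (Equiv.swap x (x + 1) z) (Equiv.swap x (x + 1) y) - B z y =
      (if z = x then B (z + 1) y - B z y else 0) + (if y - 1 = x then B z (y - 1) - B z y else 0)
      + (if z - 1 = x then B (z - 1) y - B z y else 0)
      + (if y = x then B z (y + 1) - B z y else 0) := by
    intro x
    simp only [Equiv.swap_apply_def]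
    split_ifs <;> first | omega | (subst_vars; simp)
  unfold pairGen
  simp only [e, Finset.sum_add_distrib, Finset.sum_ite_eq, Finset.mem_Ico]
  congr 2
  · congr 1
    · congr 1
      · split_ifs <;> first | rfl | omega
      · split_ifs <;> first | rfl | omega
    · rw [if_pos (by omega)]
  · rw [if_pos (by omega)]

/-- Exchanging the two sites of the pair itself does nothing to a symmetric weight, so only the
outward moves remain. -/
theorem pairGen_of_adjacent {B : ℤ → ℤ → ℝ} (hB : ∀ z y, B z y = B y z) {y : ℤ}
    (hy : -(N : ℤ) ≤ y) (hz : y + 1 ≤ N) :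
    pairGen N B (y + 1) y = 1 / 2 * ((if y + 1 < N then B (y + 2) y - B (y + 1) y else 0) +
      (if -(N : ℤ) < y then B (y + 1) (y - 1) - B (y + 1) y else 0)) := by
  have e : ∀ x : ℤ, B (Equiv.swap x (x + 1) (y + 1)) (Equiv.swap x (x + 1) y) - B (y + 1) y =
      (if y + 1 = x then B (y + 2) y - B (y + 1) y else 0)
      + (if y - 1 = x then B (y + 1) (y - 1) - B (y + 1) y else 0) := by
    intro x
    simp only [Equiv.swap_apply_def]
    split_ifs <;> first | omega | (subst_vars; simp; done) | skip
    · rw [show x + 1 = y + 2 by omega, add_zero]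
    · obtain rfl : y = x := by omega
      simp [hB y (y + 1)]
  unfold pairGen
  simp only [e, Finset.sum_add_distrib, Finset.sum_ite_eq, Finset.mem_Ico]
  congr 2
  · split_ifs <;> first | rfl | omega
  · split_ifs <;> first | rfl | omega

section Grid

variable {ε β : ℝ} {P : ℤ → ℤ → ℝ}

/-- The shift by one in the second coordinate puts adjacent pairs on the diagonal. There the
symmetric extension counts each of the two outward moves twice, hence 1/4 instead of 1/2; at the
walls, reflection turns the missing moves into zero increments. -/
theorem pairGen_pairOfGrid (hP : IsGridWeight N ε β P) {a b : ℤ} (ha : 0 ≤ a) (hab : a ≤ b)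
    (hb : b ≤ 2 * N - 1) :
    pairGen N (pairOfGrid N P) (N - a) (N - 1 - b) =
      (if a < b then 1 / 2 else 1 / 4) * gridLap P a b := by
  have e0 : pairOfGrid N P (N - a) (N - 1 - b) = P a b := by
    rw [pairOfGrid_of_lt _ (by omega)]; congr 1 <;> ring
  have e1 : (if (N : ℤ) - a < N then
      pairOfGrid N P (N - a + 1) (N - 1 - b) - P a b else 0) = P (a - 1) b - P a b := by
    split_ifs with h
    · rw [pairOfGrid_of_lt _ (by omega)]; congr 2 <;> ring
    · obtain rfl : a = 0 := by omega
      have := hP.reflect_left b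
      simp [this]
  have e2 : (if -(N : ℤ) < N - 1 - b then
      pairOfGrid N P (N - a) (N - 1 - b - 1) - P a b else 0) = P a (b + 1) - P a b := by
    split_ifs with h
    · rw [pairOfGrid_of_lt _ (by omega)]; congr 2 <;> ring
    · obtain rfl : b = 2 * N - 1 := by omega
      have := hP.reflect_right a
      rw [hP.symm a, hP.symm a, sub_add_cancel, this, sub_self]
  split_ifs with h
  · rw [pairGen_of_gap (by omega) (by omega) (by omega), e0, e1, e2,
      pairOfGrid_of_lt _ (by omega : (N : ℤ) - 1 - b < N - a - 1),
      pairOfGrid_of_lt _ (by omega : (N : ℤ) - 1 - b + 1 < N - a), gridLap,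
      show (N : ℤ) - (N - a - 1) = a + 1 by ring, show (N : ℤ) - 1 - (N - 1 - b) = b by ring,
      show (N : ℤ) - (N - a) = a by ring, show (N : ℤ) - 1 - (N - 1 - b + 1) = b - 1 by ring]
    ring
  · obtain rfl : a = b := by omega
    have hN : (N : ℤ) - a = N - 1 - a + 1 := by ring
    have := pairGen_of_adjacent (N := N) (pairOfGrid_comm (N := N) P) (y := N - 1 - a) (by omega) (by omega)
    rw [← hN, show (N : ℤ) - 1 - a + 2 = N - a + 1 by ring, e0, e1, e2] at this
    rw [this, gridLap, hP.symm (a + 1), hP.symm a (a - 1)]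
    ring

theorem isPairWeight_of_lt (hP : IsGridWeight N ε β P) (hε : 0 ≤ ε) (hβ : 0 ≤ β) {z y : ℤ}
    (hy : -(N : ℤ) ≤ y) (hz : z ≤ N) (h : y < z) :
    β + ε * pushLoss N (pairOfGrid N P) z y + ε * deathLoss N (pairOfGrid N P) z y ≤
      pairGen N (pairOfGrid N P) z y + ε * cornerGain N z y := by
  obtain ⟨a, rfl⟩ : ∃ a : ℤ, z = N - a := ⟨N - z, by ring⟩
  obtain ⟨b, rfl⟩ : ∃ b : ℤ, y = N - 1 - b := ⟨N - 1 - y, by ring⟩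
  have ha : 0 ≤ a := by omega
  have hab : a ≤ b := by omega
  have hb : b ≤ 2 * N - 1 := by omega
  have e0 : pairOfGrid N P (N - a) (N - 1 - b) = P a b := by
    rw [pairOfGrid_of_lt _ (by omega)]; congr 1 <;> ring
  have ed : deathLoss N (pairOfGrid N P) (N - a) (N - 1 - b) =
      if 2 * (N : ℤ) - 2 ≤ b then P a b else 0 := by
    rw [deathLoss, e0, min_eq_right (by omega)]
    split_ifs <;> first | rfl | omega
  rw [pairGen_pairOfGrid hP ha hab hb, ed]
  rcases eq_or_lt_of_le (show 0 ≤ b by omega) with rfl | hb1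
  · obtain rfl : a = 0 := by omega
    have e1 : pushLoss N (pairOfGrid N P) (N - 0) (N - 1 - 0) = 0 := if_neg (by omega)
    have e2 : cornerGain N (N - 0) (N - 1 - 0) = 1 / 2 := if_pos (by left; constructor <;> ring)
    have e3 := hP.reflect_left 0
    have e4 := hP.corner
    rw [e1, e2, if_neg (lt_irrefl _), gridLap]
    simp only [zero_sub, zero_add]
    rw [hP.symm 1 0, hP.symm 0 (-1), e3]
    linarith
  · have g := hP.gen a b ha hab hb1 hb
    have e1 : pushLoss N (pairOfGrid N P) (N - a) (N - 1 - b) =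
        if a = 0 then P 0 b - P 1 b else 0 := by
      unfold pushLoss
      split_ifs with h1 h2 h2
      · subst h2
        rw [pairOfGrid_of_lt _ (by omega), pairOfGrid_of_lt _ (by omega)]
        congr 2 <;> ring
      · omega
      · omega
      · rfl
    have e2 : cornerGain N (N - a) (N - 1 - b) = 0 := if_neg (by omega)
    have hpos : 0 ≤ 1 / 4 * gridLap P a b := by
      refine le_trans ?_ g
      have h1 : 0 ≤ if a = 0 then P 0 b - P 1 b else 0 := by
        split_ifs
        · linarith [hP.anti b hb1 hb]
        · exact le_rfl
      have h2 : 0 ≤ if 2 * (N : ℤ) - 2 ≤ b then P a b else 0 := by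
        split_ifs
        · exact hP.nonneg _ _
        · exact le_rfl
      positivity
    rw [e1, e2]
    split_ifs with h1 <;> split_ifs at g <;> linarith

/-- The sites on either side of z contribute at most the sum of h, so 1/8 each. -/
theorem sum_pairOfGrid_le (hP : IsGridWeight N ε β P) {z : ℤ}
    (hz : z ∈ Finset.Icc (-(N : ℤ)) N) :
    ∑ y ∈ Finset.Icc (-(N : ℤ)) N, pairOfGrid N P z y ≤ 1 / 4 := by
  obtain ⟨h, hPh, h0, hsum⟩ := hP.sum_le
  rw [Finset.mem_Icc] at hz
  have hterm : ∀ y ∈ Finset.Icc (-(N : ℤ)) N, pairOfGrid N P z y ≤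
      (if y ≤ N - 1 then h (N - 1 - y) else 0) + (if -(N : ℤ) + 1 ≤ y then h (N - y) else 0) := by
    intro y hy
    rw [Finset.mem_Icc] at hy
    have p1 : 0 ≤ if y ≤ N - 1 then h (N - 1 - y) else 0 := by
      split_ifs <;> first | exact h0 _ (by omega) (by omega) | exact le_rfl
    have p2 : 0 ≤ if -(N : ℤ) + 1 ≤ y then h (N - y) else 0 := by
      split_ifs <;> first | exact h0 _ (by omega) (by omega) | exact le_rfl
    rcases lt_trichotomy y z with hlt | rfl | hlt
    · rw [pairOfGrid_of_lt _ hlt]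
      have := hPh (N - z) (N - 1 - y) (by omega) (by omega) (by omega)
      rw [if_pos (by omega)]
      linarith
    · rw [pairOfGrid, if_pos rfl]
      linarith
    · rw [pairOfGrid_comm, pairOfGrid_of_lt _ hlt, hP.symm]
      have := hPh (N - 1 - z) (N - y) (by omega) (by omega) (by omega)
      rw [if_pos (by omega : -(N : ℤ) + 1 ≤ y)]
      linarith
  refine (Finset.sum_le_sum hterm).trans ?_
  rw [Finset.sum_add_distrib, ← Finset.sum_filter, ← Finset.sum_filter]
  have s1 : ∑ y ∈ (Finset.Icc (-(N : ℤ)) N).filter (fun y : ℤ => y ≤ N - 1), h (N - 1 - y) =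
      ∑ c ∈ Finset.Icc (0 : ℤ) (2 * N - 1), h c := by
    refine Finset.sum_bij' (fun (y : ℤ) _ => (N : ℤ) - 1 - y) (fun (c : ℤ) _ => (N : ℤ) - 1 - c) ?_ ?_ ?_ ?_ ?_
    all_goals intro y hy
    all_goals simp only [Finset.mem_filter, Finset.mem_Icc] at *
    all_goals first | rfl | omega
  have s2 : ∑ y ∈ (Finset.Icc (-(N : ℤ)) N).filter (fun y : ℤ => -(N : ℤ) + 1 ≤ y), h (N - y) =
      ∑ c ∈ Finset.Icc (0 : ℤ) (2 * N - 1), h c := by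
    refine Finset.sum_bij' (fun (y : ℤ) _ => (N : ℤ) - y) (fun (c : ℤ) _ => (N : ℤ) - c) ?_ ?_ ?_ ?_ ?_
    all_goals intro y hy
    all_goals simp only [Finset.mem_filter, Finset.mem_Icc] at *
    all_goals first | rfl | omega
  rw [s1, s2]
  linarith

theorem IsGridWeight.isPairWeight (hP : IsGridWeight N ε β P) (hε : 0 ≤ ε) (hβ : 0 ≤ β) :
    IsPairWeight N ε β (pairOfGrid N P) where
  diag x := if_pos rfl
  nonneg z y := by
    unfold pairOfGrid
    split_ifs
    · exact le_rfl
    · exact hP.nonneg _ _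
  push y hy h := by
    rw [pairOfGrid_of_lt _ h, pairOfGrid_of_lt _ (by omega), sub_self,
      show (N : ℤ) - (N - 1) = 1 by ring]
    exact hP.anti _ (by omega) (by omega)
  sum_le z hz := sum_pairOfGrid_le hP hz
  gen z hz y hy h := by
    rw [Finset.mem_Icc] at hz hy
    rcases lt_or_gt_of_ne h with hlt | hlt
    · have key := isPairWeight_of_lt hP hε hβ hz.1 hy.2 hlt
      have e1 : pushLoss N (pairOfGrid N P) z y = 0 := if_neg (by omega)
      have e2 : 0 ≤ pushLoss N (pairOfGrid N P) y z := by
        unfold pushLoss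
        split_ifs with h1
        · rw [pairOfGrid_of_lt _ h1.2, pairOfGrid_of_lt _ (by omega), sub_self,
            show (N : ℤ) - (N - 1) = 1 by ring]
          linarith [hP.anti (N - 1 - z) (by omega) (by omega)]
        · exact le_rfl
      have e3 : deathLoss N (pairOfGrid N P) z y = deathLoss N (pairOfGrid N P) y z := by
        rw [deathLoss, deathLoss, min_comm, pairOfGrid_comm]
      have e4 : cornerGain N z y = cornerGain N y z := by
        unfold cornerGain
        split_ifs <;> first | rfl | omega
      rw [pairGen_comm (pairOfGrid_comm P), e1, e3, e4]
      have := mul_nonneg hε e2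
      linarith
    · exact isPairWeight_of_lt hP hε hβ hy.1 hz.2 hlt

end Grid

end CurrentReservoir

/-! ### A crude weight for each fixed N -/

namespace CurrentReservoir

variable {N : ℕ}

/-- The triangular numbers `b(b+1)/2` for `b ≤ 2N-2`, with a shorter last step to `2N-1`, after
which the sequence is constant. -/
def tri (N : ℕ) (b : ℤ) : ℝ :=
  if b ≤ 2 * N - 2 then (b : ℝ) * (b + 1) / 2 else (2 * N - 2) * (2 * N - 1) / 2 + N

theorem tri_of_le {b : ℤ} (h : b ≤ 2 * N - 2) : tri N b = (b : ℝ) * (b + 1) / 2 := if_pos h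

theorem tri_of_gt {b : ℤ} (h : 2 * N - 2 < b) : tri N b = (2 * N - 2) * (2 * N - 1) / 2 + N :=
  if_neg (not_le.mpr h)

theorem tri_sub_one {b : ℤ} (h : b ≤ 2 * N - 2) : tri N (b - 1) = tri N b - b := by
  rw [tri_of_le h, tri_of_le (by omega)]; push_cast; ring

theorem tri_add_one {b : ℤ} (h : b ≤ 2 * N - 3) : tri N (b + 1) = tri N b + (b + 1) := by
  rw [tri_of_le (by omega : b + 1 ≤ 2 * N - 2), tri_of_le (by omega)]; push_cast; ring

theorem tri_last : tri N (2 * N - 1) = tri N (2 * N - 2) + N := by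
  rw [tri_of_le le_rfl, tri_of_gt (by omega)]; push_cast; ring

theorem tri_nonneg {b : ℤ} (hN : 1 ≤ N) (h : 0 ≤ b) : 0 ≤ tri N b := by
  have h1 : (1 : ℝ) ≤ N := by exact_mod_cast hN
  have h2 : (0 : ℝ) ≤ b := by exact_mod_cast h
  unfold tri
  split_ifs
  · positivity
  · have : 0 ≤ (2 * (N : ℝ) - 2) * (2 * N - 1) := mul_nonneg (by linarith) (by linarith)
    linarith

theorem tri_le {b : ℤ} (hN : 1 ≤ N) (h : 0 ≤ b) : tri N b ≤ 2 * (N : ℝ) ^ 2 := by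
  have h1 : (1 : ℝ) ≤ N := by exact_mod_cast hN
  have h2 : (0 : ℝ) ≤ b := by exact_mod_cast h
  unfold tri
  split_ifs with h3
  · have h3 : (b : ℝ) ≤ 2 * N - 2 := by exact_mod_cast h3
    nlinarith
  · nlinarith

theorem one_le_tri {b : ℤ} (hN : 1 ≤ N) (h : 1 ≤ b) : 1 ≤ tri N b := by
  have h1 : (1 : ℝ) ≤ N := by exact_mod_cast hN
  have h2 : (1 : ℝ) ≤ b := by exact_mod_cast h
  unfold tri
  split_ifs
  · nlinarith
  · have : 0 ≤ (2 * (N : ℝ) - 2) * (2 * N - 1) := mul_nonneg (by linarith) (by linarith)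
    linarith

theorem tri_zero (hN : 1 ≤ N) : tri N 0 = 0 := by
  rw [tri_of_le (by omega)]; simp

theorem tri_one_le (hN : 1 ≤ N) : tri N 1 = 1 := by
  rcases Nat.lt_or_ge N 2 with h | h
  · obtain rfl : N = 1 := by omega
    rw [tri_of_gt (by norm_num)]; norm_num
  · rw [tri_of_le (by omega)]; norm_num

theorem tri_neg_one (hN : 1 ≤ N) : tri N (-1) = tri N 0 := by
  rw [tri_of_le (by omega), tri_of_le (by omega)]; norm_num

theorem tri_two_mul : tri N (2 * N) = tri N (2 * N - 1) := by
  rw [tri_of_gt (by omega), tri_of_gt (by omega)]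

/-- Each step down decreases `tri` by at least one. -/
theorem tri_sub_one_le (hN : 1 ≤ N) {b : ℤ} (h1 : 1 ≤ b) (h2 : b ≤ 2 * N - 1) :
    tri N (b - 1) ≤ tri N b - 1 := by
  have hN' : (1 : ℝ) ≤ N := by exact_mod_cast hN
  have h1' : (1 : ℝ) ≤ b := by exact_mod_cast h1
  rcases lt_or_ge b (2 * N - 1) with h | h
  · rw [tri_sub_one (by omega)]; linarith
  · obtain rfl : b = 2 * N - 1 := by omega
    rw [tri_last, show (2 * (N : ℤ) - 1 - 1) = 2 * N - 2 by ring]; linarith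

/-- Grid weights for each fixed `N`. -/
theorem exists_isGridWeight (hN : 1 ≤ N) {j : ℝ} (hj : 0 < j) :
    ∃ β > 0, ∃ P, IsGridWeight N (j / (2 * N)) β P := by
  have hN' : (1 : ℝ) ≤ N := by exact_mod_cast hN
  set ε : ℝ := j / (2 * N) with hε
  have hε0 : 0 < ε := by positivity
  have hεj : 2 * ε ≤ j := by
    rw [hε, ← mul_div_assoc, div_le_iff₀ (by positivity)]; nlinarith
  -- One step down in b multiplies P by at least 4(2 + j). This neighbour alone makes a quarter of
  -- the Laplacian at least (1 + j)P, which covers β and both losses because 2ε ≤ j.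
  set D : ℝ := Real.log (4 * (2 + j)) with hD
  have heD : Real.exp D = 4 * (2 + j) := Real.exp_log (by positivity)
  have hD0 : 0 ≤ D := Real.log_nonneg (by linarith)
  -- The first bound serves the corner condition, the second keeps the sum of 2N terms below 1/8.
  set θ : ℝ := min (ε / (2 * (ε + 2))) (1 / (16 * N)) with hθ
  have hθ0 : 0 < θ := by rw [hθ]; positivity
  have hθ1 : θ * (2 * (ε + 2)) ≤ ε := by
    rw [← le_div_iff₀ (by positivity)]; exact min_le_left _ _
  have hθ2 : θ * (16 * N) ≤ 1 := by
    rw [← le_div_iff₀ (by positivity)]; exact min_le_right _ _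
  let P : ℤ → ℤ → ℝ := fun a b => θ * Real.exp (-(D * (tri N a + tri N b)))
  have hP0 : ∀ a b, 0 < P a b := fun a b => by positivity
  have hPle : ∀ a b : ℤ, 0 ≤ a → 0 ≤ b → P a b ≤ θ := by
    intro a b ha hb
    refine mul_le_of_le_one_right hθ0.le (Real.exp_le_one_iff.mpr ?_)
    have := mul_nonneg hD0 (add_nonneg (tri_nonneg hN ha) (tri_nonneg hN hb))
    linarith
  have hPge : ∀ a b : ℤ, 0 ≤ a → 0 ≤ b → θ * Real.exp (-(D * (4 * (N : ℝ) ^ 2))) ≤ P a b := by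
    intro a b ha hb
    have h1 := tri_le hN ha
    have h2 := tri_le hN hb
    simp only [P]
    gcongr
    linarith
  refine ⟨θ * Real.exp (-(D * (4 * (N : ℝ) ^ 2))), by positivity, P, ?_⟩
  constructor
  · intro a b; simp only [P, add_comm]
  · exact fun a b => (hP0 a b).le
  · intro b; simp only [P, tri_neg_one hN]
  · intro b; simp only [P, tri_two_mul]
  · intro b hb hb'
    simp only [P, tri_zero hN]
    have := one_le_tri hN (le_refl (1 : ℤ))
    gcongr
    linarith
  · have h1 := (hPge 0 0 le_rfl le_rfl).trans (hPle 0 0 le_rfl le_rfl)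
    have h2 := hPle 0 0 le_rfl le_rfl
    have h3 := hP0 0 1
    have h4 : ε * (if 2 * (N : ℤ) - 2 ≤ 0 then P 0 0 else 0) ≤ ε * θ := by
      gcongr
      split_ifs
      · exact h2
      · exact hθ0.le
    linarith
  · intro a b ha hab hb hb'
    have h1 := hPge a b ha (by omega)
    have h0 := hP0 a b
    have h2 : ε * (if a = 0 then P 0 b - P 1 b else 0) ≤ ε * P a b := by
      gcongr
      split_ifs with h
      · subst h; linarith [hP0 1 b]
      · exact h0.le
    have h3 : ε * (if 2 * (N : ℤ) - 2 ≤ b then P a b else 0) ≤ ε * P a b := by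
      gcongr
      split_ifs
      · exact le_rfl
      · exact h0.le
    have h4 : Real.exp D * P a b ≤ P a (b - 1) := by
      have := tri_sub_one_le hN hb hb'
      simp only [P]
      rw [mul_left_comm, ← Real.exp_add]
      gcongr
      nlinarith
    rw [heD] at h4
    have h5 := hP0 (a - 1) b
    have h6 := hP0 (a + 1) b
    have h7 := hP0 a (b + 1)
    have h8 : 2 * ε * P a b ≤ j * P a b := mul_le_mul_of_nonneg_right hεj h0.le
    unfold gridLap
    linarith
  · refine ⟨fun _ => θ, fun a b ha hb _ => hPle a b ha hb, fun _ _ _ => hθ0.le, ?_⟩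
    rw [Finset.sum_const, Int.card_Icc, nsmul_eq_mul]
    have : ((2 * (N : ℤ) - 1 + 1 - 0).toNat : ℝ) = 2 * N := by
      have : (2 * (N : ℤ) - 1 + 1 - 0).toNat = 2 * N := by omega
      rw [this]; push_cast; ring
    rw [this]
    linarith

end CurrentReservoir

/-! ### The logarithmic profile near the corner and its range -/

namespace CurrentReservoir

/-- The logarithm, modified near `0`. -/
def lg (T : ℝ) : ℝ := if T < 1 then -(1 + Real.log 6) else Real.log T

theorem lg_of_one_le {T : ℝ} (h : 1 ≤ T) : lg T = Real.log T := if_neg (not_lt.mpr h)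

theorem lg_zero : lg 0 = -(1 + Real.log 6) := if_pos zero_lt_one

/-- The discrete Laplacian of the logarithm in the variable `T = (a(a+1) + b(b+1))/2`. -/
theorem lg_laplacian {a b : ℤ} (ha : 0 ≤ a) (hab : a ≤ b) (hb : 1 ≤ b) {T : ℝ}
    (hT : T = (a * (a + 1) + b * (b + 1)) / 2) :
    (if a = 0 then 1 / T ^ 2 else 0) ≤
      4 * lg T - lg (T - a) - lg (T + (a + 1)) - lg (T - b) - lg (T + (b + 1)) := by
  have ha' : (0 : ℝ) ≤ a := by exact_mod_cast ha
  have hab' : (a : ℝ) ≤ b := by exact_mod_cast hab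
  have hb' : (1 : ℝ) ≤ b := by exact_mod_cast hb
  -- The only point with T = 0 as a neighbour; the value of `lg` at 0 is chosen to give equality
  -- here.
  by_cases h01 : a = 0 ∧ b = 1
  · obtain ⟨rfl, rfl⟩ := h01
    have hT1 : T = 1 := by rw [hT]; norm_num
    subst hT1
    have h6 : Real.log 6 = Real.log 2 + Real.log 3 := by
      rw [← Real.log_mul (by norm_num) (by norm_num)]; norm_num
    norm_num [lg]
    linarith
  have hmid : 1 ≤ T - b ∧ 1 ≤ T - a := by
    rcases eq_or_lt_of_le ha with rfl | ha1
    · have : (2 : ℝ) ≤ b := by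
        have : (2 : ℤ) ≤ b := by omega
        exact_mod_cast this
      constructor <;> (rw [hT]; push_cast; nlinarith)
    · have : (1 : ℝ) ≤ a := by exact_mod_cast ha1
      constructor <;> (rw [hT]; nlinarith)
  have hT0 : 0 < T := by linarith [hmid.1]
  rw [lg_of_one_le hmid.1, lg_of_one_le hmid.2, lg_of_one_le (by linarith [hmid.2]),
    lg_of_one_le (by linarith [hmid.2]), lg_of_one_le (by linarith [hmid.2])]
  have h1 : 0 < T - a := by linarith [hmid.2]
  have h2 : 0 < T + (a + 1) := by linarith
  have h3 : 0 < T - b := by linarith [hmid.1]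
  have h4 : 0 < T + (b + 1) := by linarith
  -- The four neighbouring values of T multiply to T⁴ minus a square, so -log T is subharmonic on
  -- the grid without error terms. For a = 0 the square is T², and the surplus 1/T² later pays for
  -- the push.
  have hprod : (T - a) * (T + (a + 1)) * ((T - b) * (T + (b + 1))) =
      T ^ 4 - (a * (a + 1) - T) ^ 2 := by
    rw [hT]; ring
  have key := Real.log_le_sub_one_of_pos
    (show 0 < (T - a) * (T + (a + 1)) * ((T - b) * (T + (b + 1))) / T ^ 4 by positivity)
  rw [Real.log_div (by positivity) (by positivity), Real.log_mul (by positivity) (by positivity),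
    Real.log_mul h1.ne' h2.ne', Real.log_mul h3.ne' h4.ne', Real.log_pow, hprod] at key
  have e : (T ^ 4 - (a * (a + 1) - T) ^ 2) / T ^ 4 - 1 = -((a * (a + 1) - T) ^ 2 / T ^ 4) := by
    field_simp; ring
  rw [e] at key
  have h5 : (if a = 0 then 1 / T ^ 2 else 0) ≤ ((a : ℝ) * (a + 1) - T) ^ 2 / T ^ 4 := by
    split_ifs with h
    · subst h
      rw [div_le_div_iff₀ (by positivity) (by positivity)]
      push_cast
      nlinarith
    · positivity
  push_cast at key
  linarith

/-- The parameters of the grid weights for large `N`. -/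
structure Params (N : ℕ) (j κ r K : ℝ) : Prop where
  j_pos : 0 < j
  kappa : κ = 1 + j ^ 2 / 4
  radius : r = Real.exp (-(8 * κ)) / (2 * κ)
  rate : K = 8 / r
  eight_le : (8 : ℝ) ≤ N
  four_mul_le : 4 * j ≤ N
  two_le : 2 ≤ r * (N : ℝ) ^ 2
  two_mul_le : 2 * K ≤ (N : ℝ) ^ 2

/-- The weight near the corner. -/
def nearWeight (N : ℕ) (κ r T : ℝ) : ℝ :=
  Real.log (r * (N : ℝ) ^ 2 / 2) - lg T + 2 * κ * T / (N : ℝ) ^ 2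

/-- The weight far from the corner. -/
def farWeight (N : ℕ) (K T : ℝ) : ℝ := 1 / 2 * Real.exp (-(2 * (K / (N : ℝ) ^ 2) * T))

/-- The maximum of the two weights. -/
def radialWeight (N : ℕ) (κ r K T : ℝ) : ℝ := max (nearWeight N κ r T) (farWeight N K T)

namespace Params

variable {N : ℕ} {j κ r K : ℝ}

theorem one_le_kappa (p : Params N j κ r K) : 1 ≤ κ := by
  rw [p.kappa]; nlinarith [sq_nonneg j]

theorem radius_pos (p : Params N j κ r K) : 0 < r := by
  have := p.one_le_kappa
  rw [p.radius]; positivity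

theorem radius_le (p : Params N j κ r K) : 2 * κ * r ≤ 1 := by
  have h := p.one_le_kappa
  have : 2 * κ * r = Real.exp (-(8 * κ)) := by rw [p.radius]; field_simp
  rw [this]
  exact Real.exp_le_one_iff.mpr (by linarith)

theorem radius_le_half (p : Params N j κ r K) : r ≤ 1 / 2 := by
  have h := p.one_le_kappa
  have h1 := p.radius_le
  have h2 := p.radius_pos
  nlinarith

theorem rate_mul (p : Params N j κ r K) : K * r = 8 := by
  rw [p.rate]; field_simp [p.radius_pos.ne']

theorem rate_ge (p : Params N j κ r K) : 16 * κ ≤ K := by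
  have h1 := p.radius_le
  have h2 := p.radius_pos
  rw [p.rate, le_div_iff₀ h2]
  linarith

theorem rate_ge_eight (p : Params N j κ r K) : 8 ≤ K := by
  have := p.rate_ge; have := p.one_le_kappa; linarith

theorem four_j_le_rate (p : Params N j κ r K) : 4 * j ≤ K := by
  have h1 := p.rate_ge
  have h2 := p.kappa
  nlinarith [sq_nonneg (j - 1)]

theorem half_le_log_two : (1 : ℝ) / 2 ≤ Real.log 2 := by
  have := Real.log_two_gt_d9; linarith

theorem log_six_pos : 0 < Real.log 6 := Real.log_pos (by norm_num)

theorem near_nonpos (p : Params N j κ r K) {T : ℝ} (h1 : r * (N : ℝ) ^ 2 ≤ T)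
    (h2 : T ≤ 4 * (N : ℝ) ^ 2) : nearWeight N κ r T ≤ 0 := by
  have hN : (0 : ℝ) < N := by have := p.eight_le; linarith
  have hκ := p.one_le_kappa
  have hr := p.radius_pos
  have hT : 1 ≤ T := by have := p.two_le; linarith
  obtain ⟨s, hs⟩ : ∃ s, s = 2 * T / (N : ℝ) ^ 2 := ⟨_, rfl⟩
  have hT' : T = s * (N : ℝ) ^ 2 / 2 := by rw [hs]; field_simp
  have hs1 : 2 * r ≤ s := by rw [hs, le_div_iff₀ (by positivity)]; linarith
  have hs2 : s ≤ 8 := by rw [hs, div_le_iff₀ (by positivity)]; linarith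
  have hs0 : 0 < s := by linarith
  have e : nearWeight N κ r T = -Real.log (s / r) + κ * s := by
    rw [nearWeight, lg_of_one_le hT, ← Real.log_div (by positivity) (by positivity),
      ← Real.log_inv]
    congr 1
    · congr 1; rw [hT']; field_simp
    · rw [hT']; field_simp
  rw [e]
  -- For small s, κs ≤ 1/2 ≤ log 2 ≤ log(s/r). For large s the choice of r gives log(s/r) ≥ 8κ ≥ κs.
  rcases le_or_gt s (1 / (2 * κ)) with h | h
  · have h3 : κ * s ≤ 1 / 2 := by
      rw [le_div_iff₀ (by positivity)] at h; linarith
    have h4 : Real.log 2 ≤ Real.log (s / r) :=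
      Real.log_le_log (by norm_num) (by rw [le_div_iff₀ hr]; exact hs1)
    have := half_le_log_two
    linarith
  · have h4 : Real.log (Real.exp (8 * κ)) ≤ Real.log (s / r) := by
      refine Real.log_le_log (Real.exp_pos _) ?_
      rw [le_div_iff₀ hr, p.radius, mul_div_assoc', ← Real.exp_add, add_neg_cancel, Real.exp_zero]
      exact h.le
    rw [Real.log_exp] at h4
    nlinarith

theorem half_le_near (p : Params N j κ r K) {T : ℝ} (h0 : 0 ≤ T)
    (h1 : T ≤ r * (N : ℝ) ^ 2 / 4) : 1 / 2 ≤ nearWeight N κ r T := by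
  have hN : (0 : ℝ) < N := by have := p.eight_le; linarith
  have hκ := p.one_le_kappa
  have h2 := p.two_le
  have h3 : 0 ≤ 2 * κ * T / (N : ℝ) ^ 2 := by positivity
  have h6 := log_six_pos
  unfold nearWeight
  by_cases hT : T < 1
  · have : 0 ≤ Real.log (r * (N : ℝ) ^ 2 / 2) := Real.log_nonneg (by linarith)
    rw [lg, if_pos hT]
    linarith
  · rw [lg, if_neg hT]
    push Not at hT
    have : Real.log 2 ≤ Real.log (r * (N : ℝ) ^ 2 / 2) - Real.log T := by
      rw [← Real.log_div (by positivity) (by positivity)]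
      exact Real.log_le_log (by norm_num) (by rw [le_div_iff₀ (by positivity)]; linarith)
    have := half_le_log_two
    linarith

theorem far_pos (N : ℕ) (K T : ℝ) : 0 < farWeight N K T := by
  unfold farWeight; positivity

theorem far_anti (p : Params N j κ r K) {T T' : ℝ} (h : T ≤ T') :
    farWeight N K T' ≤ farWeight N K T := by
  have := p.rate_ge_eight
  unfold farWeight
  gcongr

theorem radial_pos (N : ℕ) (κ r K T : ℝ) : 0 < radialWeight N κ r K T :=
  lt_max_of_lt_right (far_pos _ _ _)

theorem lt_of_far_le_near (p : Params N j κ r K) {T : ℝ} (h2 : T ≤ 4 * (N : ℝ) ^ 2)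
    (h : farWeight N K T ≤ nearWeight N κ r T) : T < r * (N : ℝ) ^ 2 := by
  by_contra hT
  push Not at hT
  have := p.near_nonpos hT h2
  have := far_pos N K T
  linarith

/-- The near weight increases for large T through its linear term, but where it exceeds the far
weight one has T' < rN², and there the logarithm dominates since 2κr ≤ 1. -/
theorem radial_anti (p : Params N j κ r K) {T T' : ℝ} (h0 : T = 0 ∨ 1 ≤ T) (h1 : 1 ≤ T')
    (h : T ≤ T') (h2 : T' ≤ 4 * (N : ℝ) ^ 2) :
    radialWeight N κ r K T' ≤ radialWeight N κ r K T := by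
  have hN : (0 : ℝ) < N := by have := p.eight_le; linarith
  refine max_le ?_ ((p.far_anti h).trans (le_max_right _ _))
  rcases le_or_gt (nearWeight N κ r T') (farWeight N K T') with h3 | h3
  · exact h3.trans ((p.far_anti h).trans (le_max_right _ _))
  refine le_trans ?_ (le_max_left _ _)
  have h4 := p.lt_of_far_le_near h2 h3.le
  have hκ := p.one_le_kappa
  have h5 : 2 * κ * T' ≤ (N : ℝ) ^ 2 := by
    have := p.radius_le
    nlinarith
  unfold nearWeight
  rcases h0 with rfl | h0
  · rw [lg_zero, lg_of_one_le h1]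
    have e1 := Real.log_nonneg h1
    have e2 : 2 * κ * T' / (N : ℝ) ^ 2 ≤ 1 := by
      rw [div_le_one (by positivity)]; exact h5
    have := log_six_pos
    simp only [mul_zero, zero_div]
    linarith
  · rw [lg_of_one_le h0, lg_of_one_le h1]
    have e1 := Real.one_sub_inv_le_log_of_pos (show 0 < T' / T by positivity)
    rw [Real.log_div (by positivity) (by positivity), inv_div] at e1
    have e2 : 2 * κ * (T' - T) / (N : ℝ) ^ 2 ≤ (T' - T) / T' := by
      rw [div_le_div_iff₀ (by positivity) (by positivity)]
      nlinarith
    have e3 : (T' - T) / T' = 1 - T / T' := by field_simp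
    have e4 : 2 * κ * (T' - T) / (N : ℝ) ^ 2 =
      2 * κ * T' / (N : ℝ) ^ 2 - 2 * κ * T / (N : ℝ) ^ 2 := by ring
    linarith

end Params

end CurrentReservoir

/-! ### The exponential profile and the gluing -/

namespace CurrentReservoir

theorem two_add_sq_le_exp_add_exp_neg (u : ℝ) : 2 + u ^ 2 ≤ Real.exp u + Real.exp (-u) := by
  wlog h : 0 ≤ u generalizing u with H
  · have := H (-u) (by linarith)
    rw [neg_neg] at this
    linarith [neg_sq u]
  have h1 : u / 2 ≤ Real.sinh (u / 2) := Real.self_le_sinh_iff.mpr (by linarith)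
  rw [Real.sinh_eq] at h1
  have h2 : Real.exp u = Real.exp (u / 2) ^ 2 := by rw [← Real.exp_nat_mul]; congr 1; push_cast; ring
  have h3 : Real.exp (-u) = Real.exp (-(u / 2)) ^ 2 := by
    rw [← Real.exp_nat_mul]; congr 1; push_cast; ring
  have h4 : Real.exp (u / 2) * Real.exp (-(u / 2)) = 1 := by rw [← Real.exp_add]; simp
  rw [h2, h3]
  nlinarith

/-- A lower bound for the second difference of `e^{-k a(a+1)}`. -/
theorem exp_second_difference (k : ℝ) (a : ℝ) :
    2 - 2 * k + (1 - k) * (k * (2 * a + 1)) ^ 2 ≤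
      Real.exp (2 * k * a) + Real.exp (-(2 * k * (a + 1))) := by
  have h1 := two_add_sq_le_exp_add_exp_neg (k * (2 * a + 1))
  have h2 := Real.one_sub_le_exp_neg k
  have e1 : Real.exp (2 * k * a) = Real.exp (-k) * Real.exp (k * (2 * a + 1)) := by
    rw [← Real.exp_add]; congr 1; ring
  have e2 : Real.exp (-(2 * k * (a + 1))) = Real.exp (-k) * Real.exp (-(k * (2 * a + 1))) := by
    rw [← Real.exp_add]; congr 1; ring
  rw [e1, e2, ← mul_add]
  calc _ = (1 - k) * (2 + (k * (2 * a + 1)) ^ 2) := by ring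
    _ ≤ _ := mul_le_mul h2 h1 (by positivity) (Real.exp_pos _).le

theorem farWeight_add (N : ℕ) (K T x : ℝ) : farWeight N K (T + x) =
    Real.exp (-(2 * (K / (N : ℝ) ^ 2) * x)) * farWeight N K T := by
  unfold farWeight
  rw [mul_left_comm, ← Real.exp_add]
  congr 2
  ring

theorem farWeight_sub (N : ℕ) (K T x : ℝ) : farWeight N K (T - x) =
    Real.exp (2 * (K / (N : ℝ) ^ 2) * x) * farWeight N K T := by
  rw [sub_eq_add_neg, farWeight_add]
  congr 2
  ring

namespace Params

variable {N : ℕ} {j κ r K : ℝ}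

theorem pos (p : Params N j κ r K) : (0 : ℝ) < N := by have := p.eight_le; linarith

theorem one_le (p : Params N j κ r K) : 1 ≤ N := by
  have := p.pos
  exact_mod_cast this

theorem step_pos (p : Params N j κ r K) : 0 < K / (N : ℝ) ^ 2 := by
  have := p.rate_ge_eight
  have := p.pos
  positivity

theorem step_le (p : Params N j κ r K) : K / (N : ℝ) ^ 2 ≤ 1 / 2 := by
  have := p.pos
  rw [div_le_div_iff₀ (by positivity) (by norm_num)]
  linarith [p.two_mul_le]

theorem near_laplacian (p : Params N j κ r K) {a b : ℤ} (ha : 0 ≤ a) (hab : a ≤ b)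
    (hb : 1 ≤ b) {T : ℝ} (hT : T = (a * (a + 1) + b * (b + 1)) / 2) :
    κ / (N : ℝ) ^ 2 + 1 / 4 * (if a = 0 then 1 / T ^ 2 else 0) ≤
      1 / 4 * (nearWeight N κ r (T - a) + nearWeight N κ r (T + (a + 1))
        + nearWeight N κ r (T - b) + nearWeight N κ r (T + (b + 1)) - 4 * nearWeight N κ r T) := by
  have h := lg_laplacian ha hab hb hT
  have hN := p.pos
  unfold nearWeight
  have e : 2 * κ * (T - a) / (N : ℝ) ^ 2 + 2 * κ * (T + (a + 1)) / (N : ℝ) ^ 2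
      + 2 * κ * (T - b) / (N : ℝ) ^ 2 + 2 * κ * (T + (b + 1)) / (N : ℝ) ^ 2
      - 4 * (2 * κ * T / (N : ℝ) ^ 2) = 4 * (κ / (N : ℝ) ^ 2) := by ring
  linarith

theorem near_push (p : Params N j κ r K) {T : ℝ} (hT : 1 ≤ T) :
    1 / (N : ℝ) ^ 2 + j / (2 * N) * (nearWeight N κ r T - nearWeight N κ r (T + 1)) ≤
      κ / (N : ℝ) ^ 2 + 1 / 4 * (1 / T ^ 2) := by
  have hN := p.pos
  have hj := p.j_pos
  have hT0 : 0 < T := by linarith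
  have h1 : nearWeight N κ r T - nearWeight N κ r (T + 1) ≤ 1 / T := by
    have h2 := Real.log_le_sub_one_of_pos (show 0 < (T + 1) / T by positivity)
    rw [Real.log_div (by positivity) (by positivity)] at h2
    have h3 : (T + 1) / T - 1 = 1 / T := by field_simp; ring
    have h4 : 2 * κ * T / (N : ℝ) ^ 2 ≤ 2 * κ * (T + 1) / (N : ℝ) ^ 2 := by
      have := p.one_le_kappa
      gcongr
      linarith
    unfold nearWeight
    rw [lg_of_one_le hT, lg_of_one_le (by linarith)]
    linarith
  have h5 : j / (2 * N) * (nearWeight N κ r T - nearWeight N κ r (T + 1)) ≤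
      j / (2 * N) * (1 / T) := by gcongr
  -- Completing the square splits the push loss between the surplus 1/(4T²) and the part j²/4 of κ.
  have h6 : j / (2 * N) * (1 / T) ≤ j ^ 2 / 4 / (N : ℝ) ^ 2 + 1 / 4 * (1 / T ^ 2) := by
    have e : j ^ 2 / 4 / (N : ℝ) ^ 2 + 1 / 4 * (1 / T ^ 2) - j / (2 * N) * (1 / T) =
        (j / (2 * N) - 1 / (2 * T)) ^ 2 := by field_simp; ring
    linarith [sq_nonneg (j / (2 * N) - 1 / (2 * T))]
  have h7 : κ / (N : ℝ) ^ 2 = 1 / (N : ℝ) ^ 2 + j ^ 2 / 4 / (N : ℝ) ^ 2 := by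
    rw [← add_div, ← p.kappa]
  linarith

/-- With k = K/N², the squares in the second differences add up to about 8k²T against a loss of 4k.
As Kr = 8, the lower bound on T gives kT ≥ 2, which is enough. -/
theorem far_laplacian (p : Params N j κ r K) {a b T : ℝ}
    (hT : T = (a * (a + 1) + b * (b + 1)) / 2) (hrT : r * (N : ℝ) ^ 2 / 4 ≤ T) :
    K / (N : ℝ) ^ 2 * farWeight N K T ≤
      1 / 4 * (farWeight N K (T - a) + farWeight N K (T + (a + 1))
        + farWeight N K (T - b) + farWeight N K (T + (b + 1)) - 4 * farWeight N K T) := by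
  have hk0 := p.step_pos
  have hk1 := p.step_le
  have hN := p.pos
  have hkT : 2 ≤ K / (N : ℝ) ^ 2 * T := by
    rw [div_mul_eq_mul_div, le_div_iff₀ (by positivity)]
    have := p.rate_mul
    have := p.rate_ge_eight
    nlinarith
  rw [farWeight_add, farWeight_add, farWeight_sub, farWeight_sub]
  set k := K / (N : ℝ) ^ 2
  have h1 := exp_second_difference k a
  have h2 := exp_second_difference k b
  have h3 : 4 * k ≤ (1 - k) * (k * (2 * a + 1)) ^ 2 + (1 - k) * (k * (2 * b + 1)) ^ 2 - 4 * k := by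
    have e : (1 - k) * (k * (2 * a + 1)) ^ 2 + (1 - k) * (k * (2 * b + 1)) ^ 2 =
        (1 - k) * k * (8 * (k * T) + 2 * k) := by rw [hT]; ring
    rw [e]
    have h5 : 16 ≤ 8 * (k * T) + 2 * k := by linarith
    have h6 : k / 2 ≤ (1 - k) * k := by nlinarith
    nlinarith
  have h4 := far_pos N K T
  nlinarith

theorem far_push (p : Params N j κ r K) (T : ℝ) :
    j / (2 * N) * (farWeight N K T - farWeight N K (T + 1)) ≤
      1 / 4 * (K / (N : ℝ) ^ 2) * farWeight N K T := by
  have hN := p.pos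
  have hj := p.j_pos
  have hk := p.step_pos
  have h0 := far_pos N K T
  rw [farWeight_add]
  have h1 := Real.one_sub_le_exp_neg (2 * (K / (N : ℝ) ^ 2) * 1)
  have h2 : farWeight N K T - Real.exp (-(2 * (K / (N : ℝ) ^ 2) * 1)) * farWeight N K T ≤
      2 * (K / (N : ℝ) ^ 2) * farWeight N K T := by nlinarith
  have h3 : j / (2 * N) ≤ 1 / 8 := by
    rw [div_le_div_iff₀ (by positivity) (by norm_num)]
    linarith [p.four_mul_le]
  calc _ ≤ 1 / 8 * (2 * (K / (N : ℝ) ^ 2) * farWeight N K T) :=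
        mul_le_mul h3 h2 (by
          have : Real.exp (-(2 * (K / (N : ℝ) ^ 2) * 1)) ≤ 1 :=
            Real.exp_le_one_iff.mpr (by linarith)
          nlinarith) (by norm_num)
    _ = _ := by ring

theorem far_lower (p : Params N j κ r K) {T : ℝ} (hT : T ≤ 4 * (N : ℝ) ^ 2) :
    Real.exp (-(8 * K)) / (N : ℝ) ^ 2 ≤ 3 / 4 * (K / (N : ℝ) ^ 2) * farWeight N K T := by
  have hN := p.pos
  have hK := p.rate_ge_eight
  have h1 : Real.exp (-(8 * K)) ≤ Real.exp (-(2 * (K / (N : ℝ) ^ 2) * T)) := by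
    apply Real.exp_le_exp.mpr
    have : 2 * (K / (N : ℝ) ^ 2) * T ≤ 2 * (K / (N : ℝ) ^ 2) * (4 * (N : ℝ) ^ 2) := by gcongr
    have e : 2 * (K / (N : ℝ) ^ 2) * (4 * (N : ℝ) ^ 2) = 8 * K := by field_simp; ring
    linarith
  unfold farWeight
  have h2 := Real.exp_pos (-(8 * K))
  calc Real.exp (-(8 * K)) / (N : ℝ) ^ 2
      ≤ (3 / 8 * K) * Real.exp (-(2 * (K / (N : ℝ) ^ 2) * T)) / (N : ℝ) ^ 2 := by
        gcongr
        nlinarith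
    _ = _ := by ring

/-- The step of `tri` at the far end of the grid dominates the loss there. -/
theorem far_boundary (p : Params N j κ r K) {a b : ℤ} (hab : a ≤ b)
    (hb : 2 * (N : ℤ) - 2 ≤ b) (hb' : b ≤ 2 * N - 1) :
    K / (4 * N) * farWeight N K (tri N a + tri N b) ≤
      1 / 4 * gridLap (fun a b => farWeight N K (tri N a + tri N b)) a b := by
  have hN := p.pos
  have hk0 := p.step_pos
  have hk1 := p.step_le
  have h8 := p.eight_le
  set k := K / (N : ℝ) ^ 2 with hk
  have hKN : K / (4 * N) = k * N / 4 := by rw [hk]; field_simp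
  have hfar := far_pos N K (tri N a + tri N b)
  -- The last step N of `tri` makes both end columns gain to first order: the steps at 2N-2 are 2N-2
  -- down and N up, those at 2N-1 are N down and 0 up. The net step is at least N-2 in either case.
  have hend : ∀ c : ℤ, 2 * (N : ℤ) - 2 ≤ c → c ≤ 2 * N - 1 → ∀ S : ℝ,
      k * (2 * N - 4) * farWeight N K (S + tri N c) ≤ farWeight N K (S + tri N (c - 1))
        + farWeight N K (S + tri N (c + 1)) - 2 * farWeight N K (S + tri N c) := by
    intro c hc hc' S
    have h0 := far_pos N K (S + tri N c)
    rcases eq_or_lt_of_le hc with rfl | hlt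
    · rw [tri_sub_one le_rfl, show 2 * (N : ℤ) - 2 + 1 = 2 * N - 1 by ring, tri_last,
        ← add_sub_assoc, ← add_assoc, farWeight_add N K (S + tri N (2 * N - 2)),
        farWeight_sub N K (S + tri N (2 * N - 2)), ← hk]
      have h1 := Real.add_one_le_exp (2 * k * ((2 * (N : ℤ) - 2 : ℤ) : ℝ))
      have h2 := Real.one_sub_le_exp_neg (2 * k * N)
      push_cast at h1 ⊢
      nlinarith
    · obtain rfl : c = 2 * N - 1 := by omega
      rw [sub_add_cancel, tri_two_mul, show 2 * (N : ℤ) - 1 - 1 = 2 * N - 2 by ring]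
      have e : S + tri N (2 * N - 2) = S + tri N (2 * N - 1) - N := by rw [tri_last]; ring
      rw [e, farWeight_sub, ← hk]
      have h1 := Real.add_one_le_exp (2 * k * (N : ℝ))
      nlinarith
  have h1 := hend b hb hb' (tri N a)
  have h2 : -(2 * k) * farWeight N K (tri N a + tri N b) ≤
      farWeight N K (tri N (a - 1) + tri N b) + farWeight N K (tri N (a + 1) + tri N b)
        - 2 * farWeight N K (tri N a + tri N b) := by
    rcases le_or_gt (2 * (N : ℤ) - 2) a with h | h
    · have h3 := hend a h (by omega) (tri N b)
      simp only [add_comm (tri N b)] at h3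
      have : 0 ≤ k * (2 * N - 4) := mul_nonneg hk0.le (by linarith)
      nlinarith
    · have e1 : tri N (a - 1) + tri N b = tri N a + tri N b - a := by
        rw [tri_sub_one (by omega)]; ring
      have e2 : tri N (a + 1) + tri N b = tri N a + tri N b + (a + 1) := by
        rw [tri_add_one (by omega)]; ring
      rw [e1, e2, farWeight_add N K (tri N a + tri N b), farWeight_sub N K (tri N a + tri N b), ← hk]
      have h3 := exp_second_difference k a
      have h4 : 0 ≤ (1 - k) * (k * (2 * a + 1)) ^ 2 := mul_nonneg (by linarith) (sq_nonneg _)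
      nlinarith
  rw [hKN]
  unfold gridLap
  have h5 : k * N ≤ k * (2 * N - 4) - 2 * k := by nlinarith
  nlinarith

theorem radial_gen (p : Params N j κ r K) {a b : ℤ} (ha : 0 ≤ a) (hab : a ≤ b) (hb : 1 ≤ b)
    (hb' : b ≤ 2 * N - 1) :
    Real.exp (-(8 * K)) / (N : ℝ) ^ 2
      + j / (2 * N) * (if a = 0 then radialWeight N κ r K (tri N 0 + tri N b)
        - radialWeight N κ r K (tri N 1 + tri N b) else 0)
      + j / (2 * N) * (if 2 * (N : ℤ) - 2 ≤ b then radialWeight N κ r K (tri N a + tri N b) else 0)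
      ≤ 1 / 4 * gridLap (fun a b => radialWeight N κ r K (tri N a + tri N b)) a b := by
  have hN := p.pos
  have hj := p.j_pos
  have hN1 := p.one_le
  have h8 := p.eight_le
  have h8' : 8 ≤ N := by exact_mod_cast h8
  obtain ⟨T, hT⟩ : ∃ T, T = tri N a + tri N b := ⟨_, rfl⟩
  have hT1 : 1 ≤ T := by
    have := tri_nonneg hN1 ha
    have := one_le_tri hN1 hb
    linarith
  have hT4 : T ≤ 4 * (N : ℝ) ^ 2 := by
    have := tri_le hN1 ha
    have := tri_le hN1 (by omega : 0 ≤ b)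
    linarith
  have hε : 0 ≤ j / (2 * (N : ℝ)) := by positivity
  have hpush : ∀ φ : ℝ → ℝ, radialWeight N κ r K T = φ T →
      (∀ x, φ x ≤ radialWeight N κ r K x) →
      j / (2 * N) * (if a = 0 then radialWeight N κ r K (tri N 0 + tri N b)
        - radialWeight N κ r K (tri N 1 + tri N b) else 0) ≤
      if a = 0 then j / (2 * N) * (φ T - φ (T + 1)) else 0 := by
    intro φ h1 h2
    split_ifs with h
    · subst h
      have e : tri N 1 + tri N b = T + 1 := by rw [hT, tri_one_le hN1, tri_zero hN1]; ring
      rw [e, ← hT, h1]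
      gcongr
      exact h2 _
    · simp
  have hlap : ∀ φ : ℝ → ℝ, radialWeight N κ r K T = φ T →
      (∀ x, φ x ≤ radialWeight N κ r K x) →
      gridLap (fun a b => φ (tri N a + tri N b)) a b ≤
        gridLap (fun a b => radialWeight N κ r K (tri N a + tri N b)) a b := by
    intro φ h1 h2
    unfold gridLap
    beta_reduce
    rw [← hT, h1]
    gcongr <;> exact h2 _
  have hbulk : b ≤ 2 * N - 3 → T = (a * (a + 1) + b * (b + 1)) / 2 := by
    intro h
    rw [hT, tri_of_le (by omega), tri_of_le (by omega)]; ring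
  have hbulk' : ∀ φ : ℝ → ℝ, b ≤ 2 * N - 3 → gridLap (fun a b => φ (tri N a + tri N b)) a b =
      φ (T - a) + φ (T + (a + 1)) + φ (T - b) + φ (T + (b + 1)) - 4 * φ T := by
    intro φ h
    unfold gridLap
    beta_reduce
    rw [tri_sub_one (by omega), tri_sub_one (by omega), tri_add_one (by omega),
      tri_add_one (by omega), ← hT,
      show tri N a - a + tri N b = T - a by rw [hT]; ring,
      show tri N a + (a + 1) + tri N b = T + (a + 1) by rw [hT]; ring,
      show tri N a + (tri N b - b) = T - b by rw [hT]; ring,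
      show tri N a + (tri N b + (b + 1)) = T + (b + 1) by rw [hT]; ring]
  -- Replacing the maximum by the branch attained at T only lowers its values at the neighbours, so
  -- the inequality is needed only for that branch.
  rcases le_total (farWeight N K T) (nearWeight N κ r T) with h | h
  · have hΦ : radialWeight N κ r K T = nearWeight N κ r T := max_eq_left h
    have hle : ∀ x, nearWeight N κ r x ≤ radialWeight N κ r K x := fun x => le_max_left _ _
    have hlt := p.lt_of_far_le_near hT4 h
    -- The near branch lives on T < rN² with r ≤ 1/2, hence never meets the far columns.
    have hb3 : b ≤ 2 * N - 3 := by
      by_contra hcon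
      have hb2 : ((2 * (N : ℤ) - 2 : ℤ) : ℝ) ≤ b := by
        have : 2 * (N : ℤ) - 2 ≤ b := by omega
        exact_mod_cast this
      have h1 : (N : ℝ) ^ 2 ≤ tri N b := by
        unfold tri
        push_cast at hb2
        split_ifs <;> nlinarith
      have h2 := tri_nonneg hN1 ha
      have h3 := p.radius_le_half
      nlinarith
    rw [if_neg (by omega : ¬ 2 * (N : ℤ) - 2 ≤ b), mul_zero, add_zero]
    have h1 := hpush _ hΦ hle
    have h2 := hlap _ hΦ hle
    have h3 := p.near_laplacian ha hab hb (hbulk hb3)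
    rw [hbulk' _ hb3] at h2
    have h4 : Real.exp (-(8 * K)) / (N : ℝ) ^ 2 ≤ 1 / (N : ℝ) ^ 2 := by
      have := p.rate_ge_eight
      gcongr
      exact Real.exp_le_one_iff.mpr (by linarith)
    have h5 := p.near_push hT1
    have h6 : 1 / (N : ℝ) ^ 2 ≤ κ / (N : ℝ) ^ 2 := by
      have := p.one_le_kappa
      gcongr
    split_ifs at h1 h3 ⊢ <;> linarith
  · have hΦ : radialWeight N κ r K T = farWeight N K T := max_eq_right h
    have hle : ∀ x, farWeight N K x ≤ radialWeight N κ r K x := fun x => le_max_right _ _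
    have h1 := hpush _ hΦ hle
    have h2 := hlap _ hΦ hle
    have h3 := p.far_push T
    have h4 := p.far_lower hT4
    have h5 := far_pos N K T
    have hk := p.step_pos
    have h6 : (if a = 0 then j / (2 * N) * (farWeight N K T - farWeight N K (T + 1)) else 0) ≤
        1 / 4 * (K / (N : ℝ) ^ 2) * farWeight N K T := by
      split_ifs
      · exact h3
      · positivity
    rcases le_or_gt b (2 * N - 3) with hb3 | hb3
    -- Closer to the corner the near weight is at least 1/2 and the far weight is smaller than 1/2.
    · have hrT : r * (N : ℝ) ^ 2 / 4 ≤ T := by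
        by_contra hcon
        have h7 := p.half_le_near (by linarith) (not_le.mp hcon).le
        have h8 : farWeight N K T < 1 / 2 := by
          unfold farWeight
          have : Real.exp (-(2 * (K / (N : ℝ) ^ 2) * T)) < 1 :=
            Real.exp_lt_one_iff.mpr (by
              have : 0 < 2 * (K / (N : ℝ) ^ 2) * T := by positivity
              linarith)
          linarith
        linarith
      rw [hbulk' _ hb3] at h2
      rw [if_neg (by omega : ¬ 2 * (N : ℤ) - 2 ≤ b), mul_zero, add_zero]
      have h7 := p.far_laplacian (hbulk hb3) hrT
      linarith
    · have h7 := p.far_boundary hab (by omega) hb'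
      rw [← hT] at h7
      rw [if_pos (by omega : 2 * (N : ℤ) - 2 ≤ b), ← hT, hΦ]
      -- The boundary gain of order K/N beats the death loss j/(2N) because K ≥ 4j and N ≥ 8.
      have h9 : K / (N : ℝ) ^ 2 + j / (2 * N) ≤ K / (4 * N) := by
        have e : K / (4 * N) - (K / (N : ℝ) ^ 2 + j / (2 * N)) =
            (K * (N - 4) - 2 * j * N) / (4 * (N : ℝ) ^ 2) := by field_simp; ring
        have h10 : 0 ≤ (K * (N - 4) - 2 * j * N) / (4 * (N : ℝ) ^ 2) := by
          apply div_nonneg _ (by positivity)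
          have := p.four_j_le_rate
          nlinarith [p.rate_ge_eight]
        linarith
      have h10 := mul_le_mul_of_nonneg_right h9 h5.le
      linarith

end Params

end CurrentReservoir

/-! ### Summability of the weight and uniformity in N -/

namespace CurrentReservoir

/-- The lower Stirling bound for log M!; it makes the sum of log(2N/(c+1)) along a grid line of
order N, which the prefactor θ/N of the weight compensates. -/
theorem mul_log_sub_le_sum_log (M : ℕ) :
    M * Real.log M - M ≤ ∑ i ∈ Finset.range M, Real.log ((i : ℝ) + 1) := by
  induction M with
  | zero => simp
  | succ M ih =>
    rw [Finset.sum_range_succ]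
    have h : (M : ℝ) * (Real.log (M + 1) - Real.log M) ≤ 1 := by
      rcases Nat.eq_zero_or_pos M with rfl | hM
      · simp
      · have hM' : (0 : ℝ) < M := by exact_mod_cast hM
        have h1 := Real.log_le_sub_one_of_pos (show 0 < ((M : ℝ) + 1) / M by positivity)
        rw [Real.log_div (by positivity) hM'.ne'] at h1
        have h2 : ((M : ℝ) + 1) / M - 1 = 1 / M := by field_simp; ring
        rw [h2] at h1
        calc _ ≤ (M : ℝ) * (1 / M) := by gcongr
          _ = 1 := by field_simp
    push_cast
    linarith

theorem sum_Icc_log_le {N : ℕ} (hN : 1 ≤ N) :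
    ∑ c ∈ Finset.Icc (0 : ℤ) (2 * N - 1), Real.log (2 * N / ((c : ℝ) + 1)) ≤ 2 * N := by
  have hN' : (0 : ℝ) < N := by exact_mod_cast hN
  have e : ∑ c ∈ Finset.Icc (0 : ℤ) (2 * N - 1), Real.log (2 * N / ((c : ℝ) + 1)) =
      ∑ i ∈ Finset.range (2 * N), Real.log (2 * N / ((i : ℝ) + 1)) := by
    refine Finset.sum_bij' (fun (c : ℤ) _ => c.toNat) (fun (i : ℕ) _ => (i : ℤ)) ?_ ?_ ?_ ?_ ?_
    · intro c hc; simp only [Finset.mem_Icc, Finset.mem_range] at *; omega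
    · intro i hi; simp only [Finset.mem_Icc, Finset.mem_range] at *; omega
    · intro c hc; simp only [Finset.mem_Icc] at hc; omega
    · intro i hi; simp
    · intro c hc
      simp only [Finset.mem_Icc] at hc
      have : ((c.toNat : ℕ) : ℝ) = (c : ℝ) := by
        have : ((c.toNat : ℕ) : ℤ) = c := Int.toNat_of_nonneg hc.1
        exact_mod_cast this
      rw [this]
  rw [e]
  have h := mul_log_sub_le_sum_log (2 * N)
  push_cast at h
  have e2 : ∑ i ∈ Finset.range (2 * N), Real.log (2 * N / ((i : ℝ) + 1)) =
      2 * N * Real.log (2 * N) - ∑ i ∈ Finset.range (2 * N), Real.log ((i : ℝ) + 1) := by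
    have : ∀ i ∈ Finset.range (2 * N), Real.log (2 * N / ((i : ℝ) + 1)) =
        Real.log (2 * N) - Real.log ((i : ℝ) + 1) := fun i _ =>
      Real.log_div (by positivity) (by positivity)
    rw [Finset.sum_congr rfl this, Finset.sum_sub_distrib, Finset.sum_const, Finset.card_range,
      nsmul_eq_mul]
    push_cast
    ring
  rw [e2]
  linarith

theorem log_six_le_two : Real.log 6 ≤ 2 := by
  have h1 : Real.log 6 = Real.log 2 + Real.log 2 + Real.log (3 / 2) := by
    rw [← Real.log_mul (by norm_num) (by norm_num), ← Real.log_mul (by norm_num) (by norm_num)]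
    norm_num
  have h2 := Real.log_two_lt_d9
  have h3 := Real.log_le_sub_one_of_pos (show (0 : ℝ) < 3 / 2 by norm_num)
  linarith

namespace Params

variable {N : ℕ} {j κ r K : ℝ}

theorem radial_zero_sub_one_le (p : Params N j κ r K) :
    radialWeight N κ r K 0 - radialWeight N κ r K 1 ≤ 3 := by
  have hN := p.pos
  have hκ := p.one_le_kappa
  have h1 := p.half_le_near le_rfl (by have := p.radius_pos; positivity)
  have h2 : farWeight N K 0 = 1 / 2 := by simp [farWeight]
  have h3 : radialWeight N κ r K 0 = nearWeight N κ r 0 := max_eq_left (by rw [h2]; exact h1)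
  have h4 : nearWeight N κ r 1 ≤ radialWeight N κ r K 1 := le_max_left _ _
  have h5 := log_six_le_two
  have h6 : 0 ≤ 2 * κ * 1 / (N : ℝ) ^ 2 := by positivity
  rw [h3]
  unfold nearWeight at h4 ⊢
  rw [lg_of_one_le le_rfl, Real.log_one] at h4
  rw [lg_zero, mul_zero, zero_div]
  linarith

theorem radial_le (p : Params N j κ r K) {a b : ℤ} (ha : 0 ≤ a) (hb : 0 ≤ b)
    (hb' : b ≤ 2 * N - 1) : radialWeight N κ r K (tri N a + tri N b) ≤
      2 * Real.log (2 * N / ((b : ℝ) + 1)) + (3 + 8 * κ) := by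
  have hN := p.pos
  have hN1 := p.one_le
  have hκ := p.one_le_kappa
  have hr := p.radius_pos
  have hb0 : (0 : ℝ) ≤ b := by exact_mod_cast hb
  have hbN : (b : ℝ) + 1 ≤ 2 * N := by
    have : b + 1 ≤ 2 * N := by omega
    exact_mod_cast this
  have hlog : 0 ≤ Real.log (2 * N / ((b : ℝ) + 1)) :=
    Real.log_nonneg (by rw [le_div_iff₀ (by positivity)]; linarith)
  have hta := tri_nonneg hN1 ha
  have htb := tri_nonneg hN1 hb
  obtain ⟨T, hT⟩ : ∃ T, T = tri N a + tri N b := ⟨_, rfl⟩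
  have hT4 : T ≤ 4 * (N : ℝ) ^ 2 := by
    have := tri_le hN1 ha
    have := tri_le hN1 hb
    linarith
  rw [← hT]
  refine max_le ?_ ?_
  · have h1 : Real.log (r * (N : ℝ) ^ 2 / 2) ≤ Real.log ((N : ℝ) ^ 2 / 2) := by
      apply Real.log_le_log (by positivity)
      have := p.radius_le_half
      gcongr
      nlinarith [sq_nonneg (N : ℝ)]
    have h2 : 2 * κ * T / (N : ℝ) ^ 2 ≤ 8 * κ := by
      rw [div_le_iff₀ (by positivity)]; nlinarith
    have h3 : -lg T ≤ Real.log 4 + 2 - 2 * Real.log ((b : ℝ) + 1) := by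
      by_cases hT1 : T < 1
      · have : b = 0 := by
          by_contra hne
          have := one_le_tri hN1 (show 1 ≤ b by omega)
          linarith
        subst this
        have h6 : Real.log 6 = Real.log 4 + Real.log (3 / 2) := by
          rw [← Real.log_mul (by norm_num) (by norm_num)]; norm_num
        have h7 := Real.log_le_sub_one_of_pos (show (0 : ℝ) < 3 / 2 by norm_num)
        rw [lg, if_pos hT1]
        norm_num at h7 ⊢
        linarith
      · push Not at hT1
        -- This turns -log T into -2 log(b+1) plus a constant, a bound in terms of b alone.
        have h4 : ((b : ℝ) + 1) ^ 2 / 4 ≤ T := by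
          rcases eq_or_lt_of_le hb with rfl | hb1
          · norm_num; linarith
          · have hb1' : (1 : ℝ) ≤ b := by exact_mod_cast hb1
            have : ((b : ℝ) + 1) ^ 2 / 4 ≤ tri N b := by
              unfold tri
              split_ifs
              · nlinarith
              · nlinarith [sq_nonneg ((N : ℝ) - 1)]
            linarith
        have h5 := Real.log_le_log (by positivity) h4
        rw [Real.log_div (by positivity) (by norm_num), Real.log_pow] at h5
        rw [lg_of_one_le hT1]
        push_cast at h5
        linarith
    have h4 : Real.log ((N : ℝ) ^ 2 / 2) + Real.log 4 + Real.log 2 = 2 * Real.log (2 * N) := by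
      rw [← Real.log_mul (by positivity) (by norm_num), ← Real.log_mul (by positivity) (by norm_num)]
      have : (N : ℝ) ^ 2 / 2 * 4 * 2 = (2 * N) ^ 2 := by ring
      rw [this, Real.log_pow]
      push_cast
      ring
    have h5 := half_le_log_two
    rw [Real.log_div (by positivity) (by positivity)]
    unfold nearWeight
    linarith
  · have h1 : farWeight N K T ≤ 1 / 2 := by
      unfold farWeight
      have hk := p.step_pos
      have hT0 : 0 ≤ T := by linarith
      have : Real.exp (-(2 * (K / (N : ℝ) ^ 2) * T)) ≤ 1 :=
        Real.exp_le_one_iff.mpr (by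
          have : 0 ≤ 2 * (K / (N : ℝ) ^ 2) * T := by positivity
          linarith)
      linarith
    linarith

theorem isGridWeight (p : Params N j κ r K) {θ : ℝ} (hθ : 0 < θ) (hθj : θ ≤ j / 10)
    (hθκ : θ * (8 * (10 + 16 * κ)) ≤ 1) :
    IsGridWeight N (j / (2 * N)) (θ / N * (Real.exp (-(8 * K)) / (N : ℝ) ^ 2))
      (fun a b => θ / N * radialWeight N κ r K (tri N a + tri N b)) := by
  have hN := p.pos
  have hN1 := p.one_le
  have h8 := p.eight_le
  have h8' : 8 ≤ N := by exact_mod_cast h8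
  have hκ := p.one_le_kappa
  have hθN : 0 < θ / N := by positivity
  constructor
  · intro a b; rw [add_comm]
  · exact fun a b => mul_nonneg hθN.le (radial_pos _ _ _ _ _).le
  · intro b; rw [tri_neg_one hN1]
  · intro b; rw [tri_two_mul]
  · intro b hb hb'
    have h1 := one_le_tri hN1 hb
    have h2 := one_le_tri hN1 (le_refl (1 : ℤ))
    have h3 := tri_le hN1 (show (0 : ℤ) ≤ 1 by norm_num)
    have h4 := tri_le hN1 (show (0 : ℤ) ≤ b by omega)
    rw [tri_zero hN1]
    exact mul_le_mul_of_nonneg_left (p.radial_anti (by right; linarith) (by linarith)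
      (by linarith) (by linarith)) hθN.le
  · rw [if_neg (by omega), mul_zero, add_zero, tri_zero hN1, tri_one_le hN1, add_zero, zero_add]
    have h1 := p.radial_zero_sub_one_le
    have h2 : Real.exp (-(8 * K)) / (N : ℝ) ^ 2 ≤ 1 := by
      rw [div_le_one (by positivity)]
      have : Real.exp (-(8 * K)) ≤ 1 := Real.exp_le_one_iff.mpr (by linarith [p.rate_ge_eight])
      nlinarith
    have h3 : j / (2 * N) / 2 = (j / 4) / N := by field_simp; ring
    -- In units of θ/N the corner needs at most 1 for the gain and 3/2 for half the drop between T =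
    -- 0 and T = 1; hence θ ≤ j/10.
    have h4 : θ / N * (5 / 2) ≤ (j / 4) / N := by
      rw [div_mul_eq_mul_div]
      gcongr
      linarith
    rw [h3]
    nlinarith
  · intro a b ha hab hb hb'
    have h := mul_le_mul_of_nonneg_left (p.radial_gen ha hab hb hb') hθN.le
    unfold gridLap at h ⊢
    beta_reduce at h ⊢
    split_ifs at h ⊢ <;> linarith
  · refine ⟨fun b => θ / N * (2 * Real.log (2 * N / ((b : ℝ) + 1)) + (3 + 8 * κ)), ?_, ?_, ?_⟩
    · exact fun a b ha hb hb' => mul_le_mul_of_nonneg_left (p.radial_le ha hb hb') hθN.le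
    · intro b hb hb'
      have := (radial_pos N κ r K _).le.trans (p.radial_le le_rfl hb hb')
      positivity
    · have h := sum_Icc_log_le hN1
      rw [← Finset.mul_sum, Finset.sum_add_distrib, ← Finset.mul_sum, Finset.sum_const,
        Int.card_Icc, nsmul_eq_mul]
      have e : ((2 * (N : ℤ) - 1 + 1 - 0).toNat : ℝ) = 2 * N := by
        have : (2 * (N : ℤ) - 1 + 1 - 0).toNat = 2 * N := by omega
        rw [this]; push_cast; ring
      rw [e]
      calc _ ≤ θ / N * (2 * (2 * N) + 2 * N * (3 + 8 * κ)) := by gcongr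
        _ = θ * (10 + 16 * κ) := by field_simp; ring
        _ ≤ _ := by linarith

end Params

/-- The grid weights for large `N` have a spectral gap of the order `N⁻²`. -/
theorem exists_isGridWeight_of_large {j : ℝ} (hj : 0 < j) :
    ∃ b > 0, ∃ N₀ : ℕ, ∀ N : ℕ, N₀ ≤ N → ∃ β > 0, ∃ P, IsGridWeight N (j / (2 * N)) β P ∧
      b ≤ 2 * N * β * (N : ℝ) ^ 2 := by
  set κ : ℝ := 1 + j ^ 2 / 4 with hκ
  set r : ℝ := Real.exp (-(8 * κ)) / (2 * κ) with hr
  set K : ℝ := 8 / r with hK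
  have hκ0 : 0 < κ := by positivity
  have hr0 : 0 < r := by positivity
  have hK0 : 0 < K := by positivity
  set θ : ℝ := min (j / 10) (1 / (8 * (10 + 16 * κ))) with hθ
  have hθ0 : 0 < θ := by rw [hθ]; positivity
  refine ⟨2 * θ * Real.exp (-(8 * K)), by positivity, ⌈8 + 4 * j + 2 / r + 2 * K⌉₊,
    fun N hN => ?_⟩
  have hN' : 8 + 4 * j + 2 / r + 2 * K ≤ N := Nat.ceil_le.mp hN
  have h2r : 0 < 2 / r := by positivity
  have h8 : (8 : ℝ) ≤ N := by linarith
  have hNpos : (0 : ℝ) < N := by linarith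
  have p : Params N j κ r K := by
    refine ⟨hj, rfl, rfl, rfl, h8, by linarith, ?_, ?_⟩
    · have h1 : 2 / r ≤ N := by linarith
      rw [div_le_iff₀ hr0] at h1
      nlinarith
    · nlinarith
  refine ⟨_, by positivity, _, p.isGridWeight hθ0 (min_le_left _ _) ?_, ?_⟩
  · rw [← le_div_iff₀ (by positivity)]
    exact min_le_right _ _
  · apply le_of_eq
    field_simp

/-- Below the threshold N₀ only finitely many rates occur, each positive, so their minimum with the
large-N rate serves all N. -/
theorem exists_isGridWeight_uniform {j : ℝ} (hj : 0 < j) :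
    ∃ b > 0, ∀ N : ℕ, 1 ≤ N → ∃ β > 0, ∃ P, IsGridWeight N (j / (2 * N)) β P ∧
      b ≤ 2 * N * β * (N : ℝ) ^ 2 := by
  obtain ⟨b₁, hb₁, N₀, hlarge⟩ := exists_isGridWeight_of_large hj
  have hsmall : ∀ n : ℕ, ∃ b > 0, ∀ N : ℕ, 1 ≤ N → N < n →
      ∃ β > 0, ∃ P, IsGridWeight N (j / (2 * N)) β P ∧ b ≤ 2 * N * β * (N : ℝ) ^ 2 := by
    intro n
    induction n with
    | zero => exact ⟨1, one_pos, fun N _ h => absurd h (Nat.not_lt_zero N)⟩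
    | succ n ih =>
      obtain ⟨b, hb, h⟩ := ih
      rcases Nat.eq_zero_or_pos n with rfl | hn
      · exact ⟨b, hb, fun N h1 h2 => by omega⟩
      obtain ⟨β, hβ, P, hP⟩ := exists_isGridWeight hn hj
      have hn' : (0 : ℝ) < n := by exact_mod_cast hn
      refine ⟨min b (2 * n * β * (n : ℝ) ^ 2), lt_min hb (by positivity), fun N h1 h2 => ?_⟩
      rcases Nat.lt_succ_iff_lt_or_eq.mp h2 with h3 | rfl
      · obtain ⟨β', hβ', P', hP', hle⟩ := h N h1 h3
        exact ⟨β', hβ', P', hP', (min_le_left _ _).trans hle⟩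
      · exact ⟨β, hβ, P, hP, min_le_right _ _⟩
  obtain ⟨b₂, hb₂, hsmall⟩ := hsmall N₀
  refine ⟨min b₁ b₂, lt_min hb₁ hb₂, fun N hN => ?_⟩
  rcases lt_or_ge N N₀ with h | h
  · obtain ⟨β, hβ, P, hP, hle⟩ := hsmall N hN h
    exact ⟨β, hβ, P, hP, (min_le_right _ _).trans hle⟩
  · obtain ⟨β, hβ, P, hP, hle⟩ := hlarge N h
    exact ⟨β, hβ, P, hP, (min_le_left _ _).trans hle⟩

end CurrentReservoir

end

theorem theorem3p1 (j : ℝ) (hj : 0 < j) :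
    ∃ c b : ℝ, 0 < c ∧ 0 < b ∧
      ∀ N : ℕ, 1 ≤ N →
        ∃ μst : CurrentReservoir.Config N → ℝ,
          CurrentReservoir.IsStationary N j μst ∧
          (∀ ν : CurrentReservoir.Config N → ℝ, CurrentReservoir.IsStationary N j ν → ν = μst) ∧
          ∀ μ : CurrentReservoir.Config N → ℝ, CurrentReservoir.IsProb μ →
            ∀ t : ℝ, 0 < t →
              CurrentReservoir.tvNorm (CurrentReservoir.law N j t μ - μst) ≤
                c * (N : ℝ) * Real.exp (-(b * ((N : ℝ) ^ 2)⁻¹ * t)) := by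
  obtain ⟨b, hb, h⟩ := CurrentReservoir.exists_isGridWeight_uniform hj
  refine ⟨12, b, by norm_num, hb, fun N hN => ?_⟩
  have hN' : (0 : ℝ) < N := by exact_mod_cast hN
  obtain ⟨β, hβ, P, hP, hle⟩ := h N hN
  obtain ⟨μst, h1, h2, h3⟩ := CurrentReservoir.exists_stationary_of_isPairWeight hN hj.le hβ rfl
    (hP.isPairWeight (by positivity) hβ.le)
  refine ⟨μst, h1, h2, fun μ hμ t ht => (h3 μ hμ t ht).trans ?_⟩
  have hrate : b * ((N : ℝ) ^ 2)⁻¹ ≤ 2 * N * β := by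
    rw [← div_eq_mul_inv, div_le_iff₀ (by positivity)]
    exact hle
  gcongr
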